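/- For $\rho>1$ let $\mathcal{E}_\rho=\{(u+u^{-1})/2 : u\in\mathbb{C},\ |u|=\rho\}$ be the Bernstein ellipse (with foci $\pm1$ and major semi-axis $(\rho+\rho^{-1})/2$), and let $L(\mathcal{E}_\rho)$ be the length of its circumference. For $\lambda>-1/2$, $\lambda\neq0$, and an integer $n\ge0$ let $$C_n^\lambda(x)=\frac{(2\lambda)_n}{n!}\,{}_2F_1\!\left[-n,\,n+2\lambda;\ \lambda+\tfrac12;\ \tfrac{1-x}{2}\right]$$ be the Gegenbauer polynomial of degree $n$, where $(z)_n=z(z+1)\cdots(z+n-1)$ is the Pochhammer symbol, and let $$h_n^\lambda=\frac{\pi\,2^{1-2\lambda}\,\Gamma(n+2\lambda)}{\Gamma(\lambda)^2\,\Gamma(n+1)\,(n+\lambda)}.$$ **Theorem.** Let $\rho>1$, and let $f$ be analytic in the open region bounded by $\mathcal{E}_\rho$ and continuous on the closure of this region. Let $\lambda>-1/2$, $\lambda\ne0$, let $M=\max_{z\in\mathcal{E}_\rho}|f(z)|$, and let $$a_k^\lambda=\frac{1}{h_k^\lambda}\int_{-1}^{1}(1-x^2)^{\lambda-1/2}\,C_k^\lambda(x)\,f(x)\,\mathrm{d}x\qquad(k\ge0)$$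 be the Gegenbauer coefficients of $f$. Then $$|a_0^\lambda|\le D_\lambda(\rho)\begin{cases}\dfrac{1}{|\Gamma(\lambda)|}, & -1/2<\lambda<0,\\[6pt] \lambda, & 0<\lambda\le1,\\[6pt] \dfrac{1}{\Gamma(\lambda)}, & \lambda>1,\end{cases}\qquad\text{and}\qquad |a_k^\lambda|\le D_\lambda(\rho)\,\frac{k^{1-\lambda}}{\rho^k}\quad\text{for all } k\ge1,$$ where $$D_\lambda(\rho)=\frac{M\,L(\mathcal{E}_\rho)}{\pi\rho}\begin{cases}\dfrac{|\Gamma(\lambda)|\,\Gamma(1+\lambda)\,\Gamma(1-2\lambda)}{\Gamma(1-\lambda)}\left(1-\dfrac1{\rho^2}\right)^{2\lambda-1}, & -1/2<\lambda<0,\\[8pt] \dfrac1\lambda\left(1-\dfrac1{\rho^2}\right)^{\lambda-1}, & 0<\lambda\le1,\\[8pt] \Gamma(\lambda)\left(1+\dfrac1{\rho^2}\right)^{\lambda-1}, & \lambda>1.\end{cases}$$ -/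

import Mathlib

/-- The Gegenbauer (ultraspherical) polynomial `C_n^lam`, as a terminating Gauss hypergeometric
series: `C_n^lam(x) = (2 lam)_n / n! * ₂F₁(-n, n + 2 lam; lam + 1/2; (1 - x)/2)`. -/
noncomputable def gegenbauerC (lam : ℝ) (n : ℕ) (x : ℝ) : ℝ :=
  (ascPochhammer ℝ n).eval (2 * lam) / (n.factorial : ℝ) *
    ordinaryHypergeometric (-(n : ℝ)) ((n : ℝ) + 2 * lam) (lam + 1 / 2) ((1 - x) / 2)

/-- The Gegenbauer weight `(1 - x^2)^(lam - 1/2)`. -/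
noncomputable def gegenbauerWeight (lam x : ℝ) : ℝ :=
  (1 - x ^ 2) ^ (lam - 1 / 2)

/-- The normalization constant `h_n^lam` (the squared weighted `L²` norm of `C_n^lam`). -/
noncomputable def gegenbauerH (lam : ℝ) (n : ℕ) : ℝ :=
  Real.pi * 2 ^ (1 - 2 * lam) * Real.Gamma ((n : ℝ) + 2 * lam) /
    (Real.Gamma lam ^ 2 * Real.Gamma ((n : ℝ) + 1) * ((n : ℝ) + lam))

/-- The Gegenbauer coefficient
`a_k^lam = (1 / h_k^lam) * ∫_{-1}^{1} (1 - x^2)^(lam - 1/2) C_k^lam(x) f(x) dx`. -/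
noncomputable def gegenbauerCoeff (f : ℂ → ℂ) (lam : ℝ) (k : ℕ) : ℂ :=
  (1 / (gegenbauerH lam k : ℂ)) *
    ∫ x in (-1 : ℝ)..1, ((gegenbauerWeight lam x * gegenbauerC lam k x : ℝ) : ℂ) * f (x : ℂ)

/-- The Bernstein ellipse `{(u + u⁻¹) / 2 : |u| = ρ}`. -/
def bernsteinEllipse (ρ : ℝ) : Set ℂ :=
  {z | ∃ u : ℂ, ‖u‖ = ρ ∧ z = (u + u⁻¹) / 2}

/-- The open region bounded by the Bernstein ellipse, which has foci `±1` and major semi-axis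
`(ρ + ρ⁻¹) / 2`: the points whose distances to the foci sum to less than `ρ + ρ⁻¹`. -/
def bernsteinInterior (ρ : ℝ) : Set ℂ :=
  {z | ‖z - 1‖ + ‖z + 1‖ < ρ + ρ⁻¹}

/-- The Bernstein ellipse is the ellipse with foci `±1` and major semi-axis `(ρ + ρ⁻¹) / 2`, so it
is the boundary curve of `bernsteinInterior ρ`. -/
theorem bernsteinEllipse_eq (ρ : ℝ) (hρ : 1 < ρ) :
    bernsteinEllipse ρ = {z | ‖z - 1‖ + ‖z + 1‖ = ρ + ρ⁻¹} := by
  have key : ∀ u : ℂ, u ≠ 0 → ‖(u + u⁻¹) / 2 - 1‖ + ‖(u + u⁻¹) / 2 + 1‖ = ‖u‖ + ‖u‖⁻¹ := by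
    intro u hu
    have h1 : (u + u⁻¹) / 2 - 1 = (u - 1) ^ 2 / (2 * u) := by field_simp; ring
    have h2 : (u + u⁻¹) / 2 + 1 = (u + 1) ^ 2 / (2 * u) := by field_simp; ring
    have hn : ‖u‖ ≠ 0 := norm_ne_zero_iff.2 hu
    have hp := parallelogram_law_with_norm ℝ u 1
    rw [h1, h2]
    simp only [norm_div, norm_pow, norm_mul, Complex.norm_ofNat]
    simp only [norm_one] at hp
    field_simp
    nlinarith
  ext z
  simp only [bernsteinEllipse, Set.mem_ofPred_eq]
  constructor
  · rintro ⟨u, hu, rfl⟩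
    have : u ≠ 0 := by rintro rfl; simp at hu; linarith
    rw [key u this, hu]
  · intro hz
    obtain ⟨s, hs⟩ := IsAlgClosed.exists_pow_nat_eq (z ^ 2 - 1) (n := 2) (by norm_num)
    have hm : (z + s) * (z - s) = 1 := by linear_combination -hs
    have h0 : z + s ≠ 0 := left_ne_zero_of_mul_eq_one hm
    have hi : (z + s)⁻¹ = z - s := inv_eq_of_mul_eq_one_right hm
    have hzz : z = ((z + s) + (z + s)⁻¹) / 2 := by rw [hi]; ring
    have hk := key _ h0
    rw [← hzz, hz] at hk
    set r := ‖z + s‖ with hr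
    have hr0 : 0 < r := norm_pos_iff.2 h0
    have : (ρ - r) * (ρ * r - 1) = 0 := by
      field_simp at hk
      linarith
    rcases mul_eq_zero.1 this with h | h
    · exact ⟨z + s, by linarith, hzz⟩
    · refine ⟨(z + s)⁻¹, ?_, ?_⟩
      · rw [norm_inv, ← hr]; field_simp; linarith
      · rw [inv_inv, add_comm]; exact hzz

/-- The parametrization `θ ↦ (ρ e^{iθ} + ρ⁻¹ e^{-iθ}) / 2` of the Bernstein ellipse. -/
noncomputable def bernsteinParam (ρ θ : ℝ) : ℂ :=
  (circleMap 0 ρ θ + (circleMap 0 ρ θ)⁻¹) / 2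

/-- The length of the circumference of the Bernstein ellipse (for `ρ > 1`), as arc length. -/
noncomputable def bernsteinLength (ρ : ℝ) : ℝ :=
  ∫ θ in (0 : ℝ)..(2 * Real.pi), ‖deriv (bernsteinParam ρ) θ‖

/-- `M = max_{z ∈ E_ρ} |f(z)|`; a maximum, since `E_ρ` is compact, if `f` is continuous on it. -/
noncomputable def bernsteinMax (f : ℂ → ℂ) (ρ : ℝ) : ℝ :=
  sSup ((fun z => ‖f z‖) '' bernsteinEllipse ρ)

/-- The constant `D_lam(ρ)`, given separately on `(-1/2, 0)`, `(0, 1]` and `(1, ∞)`. -/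
noncomputable def gegenbauerD (f : ℂ → ℂ) (lam ρ : ℝ) : ℝ :=
  bernsteinMax f ρ * bernsteinLength ρ / (Real.pi * ρ) *
    if lam < 0 then
      |Real.Gamma lam| * Real.Gamma (1 + lam) * Real.Gamma (1 - 2 * lam) / Real.Gamma (1 - lam) *
        (1 - 1 / ρ ^ 2) ^ (2 * lam - 1)
    else if lam ≤ 1 then
      1 / lam * (1 - 1 / ρ ^ 2) ^ (lam - 1)
    else
      Real.Gamma lam * (1 + 1 / ρ ^ 2) ^ (lam - 1)

/-- The factor multiplying `D_lam(ρ)` in the bound for the coefficient of index `0`. -/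
noncomputable def gegenbauerZeroFactor (lam : ℝ) : ℝ :=
  if lam < 0 then 1 / |Real.Gamma lam|
  else if lam ≤ 1 then lam
  else 1 / Real.Gamma lam

/-! Put z = (u + 1/u)/2 and let a_m be the Laurent coefficients of f(z) as a function of u. On the
unit circle z = cos θ, so on [-1, 1] the Fourier series of f(cos θ) becomes f = ∑ b_m U_m with b_m =
a_m - a_{m+2}. Cauchy's theorem moves the circle from |u| = 1 to |u| = ρ, and since dz = (1 - u⁻²)
du / 2, the difference b_m is (1/πi) ∮ f(z) u^{-m-1} dz over the ellipse
(`chebyshevUCoeff_eq_contour`).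

The k-th Gegenbauer coefficient of U_m vanishes unless m = k + 2j, where it equals Γ(λ) k!/Γ(k+λ)
times the j-th coefficient of ₂F₁(k+1, 1-λ; k+λ+1; ·) (`chebyshevMoment_eq_zero`,
`chebyshevMoment_add_two_mul`, `chebyshevMoment_div_gegenbauerH`). Summing over j gives
`gegenbauerCoeff_eq_contour`: a_k^λ = Γ(λ) k! / (πi Γ(k+λ)) ∮ f(z) u^{-k-1} ₂F₁(k+1, 1-λ; k+λ+1;
u⁻²) dz.

With |f| ≤ M, |u| = ρ and ∮ |dz| = L, two estimates remain: the hypergeometric factor on |x| = ρ⁻²,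
uniformly in k (`norm_tsum_connCoeff_le`), and the gamma quotient (`abs_connConst_le`). The product
of their constants, split by the range of λ, is the case distinction in D_λ(ρ). -/

open Polynomial

/-! ### Terminating Gauss series and the Gegenbauer differential equation -/

/-- Coefficients of the terminating Gauss series `₂F₁(-n, b; c; X)`. -/
noncomputable def hypCoeff (n : ℕ) (b c : ℝ) (k : ℕ) : ℝ :=
  (ascPochhammer ℝ k).eval (-(n : ℝ)) * (ascPochhammer ℝ k).eval b /
    ((ascPochhammer ℝ k).eval c * k.factorial)

lemma ascPochhammer_eval_pos_real {c : ℝ} (hc : 0 < c) (k : ℕ) :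
    0 < (ascPochhammer ℝ k).eval c := ascPochhammer_pos k c hc

lemma hypCoeff_eq_zero {n k : ℕ} (b c : ℝ) (h : n < k) : hypCoeff n b c k = 0 := by
  have : (ascPochhammer ℝ k).eval (-(n : ℝ)) = 0 := by
    rw [ascPochhammer_eval_eq_zero_iff]
    exact ⟨n, h, by simp⟩
  simp [hypCoeff, this]

lemma hypCoeff_succ (n : ℕ) (b : ℝ) {c : ℝ} (hc : 0 < c) (k : ℕ) :
    (k + 1) * (c + k) * hypCoeff n b c (k + 1) = (-n + k) * (b + k) * hypCoeff n b c k := by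
  have h1 := (ascPochhammer_eval_pos_real hc k).ne'
  have h2 : c + k ≠ 0 := by positivity
  have h3 : ((k.factorial : ℕ) : ℝ) ≠ 0 := by positivity
  simp only [hypCoeff, ascPochhammer_succ_eval, Nat.factorial_succ]
  push_cast
  field_simp

/-- The polynomial `₂F₁(-n, b; c; X)`. -/
noncomputable def hypPoly (n : ℕ) (b c : ℝ) : ℝ[X] :=
  ∑ k ∈ Finset.range (n + 1), C (hypCoeff n b c k) * X ^ k

lemma coeff_hypPoly (n : ℕ) (b c : ℝ) (k : ℕ) : (hypPoly n b c).coeff k = hypCoeff n b c k := by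
  simp only [hypPoly, finsetSum_coeff, coeff_C_mul_X_pow]
  by_cases h : k < n + 1
  · simp [h]
  · rw [hypCoeff_eq_zero b c (by omega)]
    simp; intros; omega

lemma eval_hypPoly (n : ℕ) (b c s : ℝ) :
    (hypPoly n b c).eval s = ordinaryHypergeometric (-(n : ℝ)) b c s := by
  rw [ordinaryHypergeometric_eq_tsum]
  beta_reduce
  rw [tsum_eq_sum (s := Finset.range (n + 1))]
  · simp only [hypPoly, eval_finsetSum, eval_mul, eval_C, eval_pow, eval_X]
    refine Finset.sum_congr rfl fun k _ => ?_
    simp only [hypCoeff, smul_eq_mul]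
    field_simp
  · intro k hk
    have h2 : (ascPochhammer ℝ k).eval (-(n : ℝ)) = 0 := by
      rw [ascPochhammer_eval_eq_zero_iff]
      exact ⟨n, by simpa using hk, by simp⟩
    simp [h2]

/-- Gauss's equation; its coefficient of X^k is the two-term recurrence `hypCoeff_succ`. -/
lemma hypPoly_ode (n : ℕ) (b : ℝ) {c : ℝ} (hc : 0 < c) :
    X * (1 - X) * derivative (derivative (hypPoly n b c)) +
      (C c - C (-n + b + 1) * X) * derivative (hypPoly n b c) =
      C (-n * b) * hypPoly n b c := by
  have e : X * (1 - X) * derivative (derivative (hypPoly n b c)) +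
      (C c - C (-n + b + 1) * X) * derivative (hypPoly n b c) =
      X * derivative (derivative (hypPoly n b c)) -
       X * (X * derivative (derivative (hypPoly n b c))) +
      C c * derivative (hypPoly n b c) - C (-n + b + 1) * (X * derivative (hypPoly n b c)) := by
    ring
  rw [e]
  ext k
  rcases k with _ | k
  · have := hypCoeff_succ n b hc 0
    simp [coeff_derivative, coeff_hypPoly] at this ⊢
    simpa [mul_assoc] using this
  · have h := hypCoeff_succ n b hc (k + 1)
    rcases k with _ | k
    all_goals
      simp only [coeff_add, coeff_sub, coeff_C_mul, coeff_X_mul, coeff_derivative, coeff_hypPoly,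
        coeff_X_mul_zero]
      push_cast at h ⊢
      linear_combination h

lemma derivative_hypPoly (n : ℕ) (b : ℝ) {c : ℝ} (hc : 0 < c) :
    derivative (hypPoly (n + 1) b c) =
      C (-(n + 1) * b / c) * hypPoly n (b + 1) (c + 1) := by
  ext k
  rw [coeff_derivative, coeff_C_mul, coeff_hypPoly, coeff_hypPoly]
  have h1 := (ascPochhammer_eval_pos_real hc k).ne'
  have h4 := (ascPochhammer_eval_pos_real (show 0 < c + 1 by linarith) k).ne'
  have h2 : c + k ≠ 0 := by positivity
  have h3 : ((k.factorial : ℕ) : ℝ) ≠ 0 := by positivity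
  have key : ∀ z : ℝ, (ascPochhammer ℝ (k + 1)).eval z = z * (ascPochhammer ℝ k).eval (z + 1) := by
    intro z; simp [ascPochhammer_succ_left, eval_comp]
  simp only [hypCoeff, key, Nat.factorial_succ]
  push_cast
  rw [show -((n : ℝ) + 1) + 1 = -n by ring]
  field_simp

/-- `₂F₁(-n, n + 2 lam; lam + 1/2; (1 - X)/2)`, the Gegenbauer polynomial with value `1` at `1`. -/
noncomputable def gegenbauerPoly (lam : ℝ) (n : ℕ) : ℝ[X] :=
  (hypPoly n (n + 2 * lam) (lam + 1 / 2)).comp (C (1 / 2) * (1 - X))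

lemma gegenbauerC_eq (lam : ℝ) (n : ℕ) (x : ℝ) :
    gegenbauerC lam n x =
      (ascPochhammer ℝ n).eval (2 * lam) / n.factorial * (gegenbauerPoly lam n).eval x := by
  simp only [gegenbauerC, gegenbauerPoly, eval_comp, eval_hypPoly]
  congr 2
  simp; ring

lemma gegenbauerPoly_zero (lam : ℝ) : gegenbauerPoly lam 0 = 1 := by
  simp [gegenbauerPoly, hypPoly, hypCoeff]

/-- Differentiation raises every parameter of the series by one, and (n+1) + 2λ + 1 = n + 2(λ+1), so
the family is preserved with λ shifted to λ + 1. -/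
lemma derivative_gegenbauerPoly {lam : ℝ} (hlam : -(1 / 2) < lam) (n : ℕ) :
    derivative (gegenbauerPoly lam (n + 1)) =
      C ((n + 1) * (n + 1 + 2 * lam) / (2 * lam + 1)) * gegenbauerPoly (lam + 1) n := by
  have h : 0 < lam + 1 / 2 := by linarith
  simp only [gegenbauerPoly, derivative_comp, derivative_hypPoly _ _ h, mul_comp, C_comp]
  rw [show ((n + 1 : ℕ) : ℝ) + 2 * lam + 1 = n + 2 * (lam + 1) by push_cast; ring,
    show lam + 1 / 2 + 1 = lam + 1 + 1 / 2 by ring]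
  simp only [derivative_mul, derivative_C, derivative_sub, derivative_one, derivative_X]
  rw [show (0 * (1 - X) + C (1 / 2) * (0 - 1) : ℝ[X]) = C (-(1 / 2)) by simp, ← mul_assoc, ← C_mul]
  congr 2
  push_cast
  have : 2 * lam + 1 ≠ 0 := by linarith
  field_simp

/-- The Gegenbauer differential operator. -/
noncomputable def gegenbauerOp (lam : ℝ) (q : ℝ[X]) : ℝ[X] :=
  (1 - X ^ 2) * derivative (derivative q) - C (2 * lam + 1) * X * derivative q

lemma gegenbauerOp_gegenbauerPoly {lam : ℝ} (hlam : -(1 / 2) < lam) (n : ℕ) :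
    gegenbauerOp lam (gegenbauerPoly lam n) =
      C (-(n * (n + 2 * lam))) * gegenbauerPoly lam n := by
  have h : 0 < lam + 1 / 2 := by linarith
  have H := congrArg (fun p => p.comp (C (1 / 2) * (1 - X))) (hypPoly_ode n (n + 2 * lam) h)
  simp only [add_comp, mul_comp, sub_comp, X_comp, one_comp, C_comp] at H
  have d : derivative (C (1 / 2) * (1 - X) : ℝ[X]) = C (-(1 / 2)) := by simp
  simp only [gegenbauerOp, gegenbauerPoly, derivative_comp, derivative_mul, derivative_C, d]
  rw [show -(n : ℝ) * (n + 2 * lam) = -(n * (n + 2 * lam)) by ring] at H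
  rw [← H, show -(n : ℝ) + (n + 2 * lam) + 1 = 2 * lam + 1 by ring,
    show lam + 1 / 2 = (2 * lam + 1) * (1 / 2) by ring, C_mul]
  have e : (C (1 / 2) : ℝ[X]) + C (1 / 2) = 1 := by
    rw [← C_add]; norm_num
  rw [C_neg]
  set t : ℝ[X] := C (1 / 2)
  have e' : (2 : ℝ[X]) * t = 1 := by rw [two_mul]; exact e
  generalize (derivative (hypPoly n (↑n + 2 * lam) ((2 * lam + 1) * (1 / 2)))).comp (t * (1 - X)) = A
  generalize (derivative (derivative (hypPoly n (↑n + 2 * lam) ((2 * lam + 1) * (1 / 2))))).comp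
    (t * (1 - X)) = B
  linear_combination t * (1 - X) * B * e'

/-! ### Integration against the Gegenbauer weight -/

lemma intervalIntegrable_gegenbauerWeight {lam : ℝ} (hlam : -(1 / 2) < lam) :
    IntervalIntegrable (gegenbauerWeight lam) MeasureTheory.volume (-1) 1 := by
  have h01 : IntervalIntegrable (gegenbauerWeight lam) MeasureTheory.volume 0 1 := by
    have h1 : IntervalIntegrable (fun x : ℝ => (1 - x) ^ (lam - 1 / 2)) MeasureTheory.volume 0 1 := by
      have := (intervalIntegral.intervalIntegrable_rpow' (a := 0) (b := 1)
        (r := lam - 1 / 2) (by linarith)).comp_sub_left 1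
      simpa using this.symm
    have h2 : ContinuousOn (fun x : ℝ => (1 + x) ^ (lam - 1 / 2)) (Set.uIcc 0 1) := by
      refine ContinuousOn.rpow_const (by fun_prop) ?_
      intro x hx
      rw [Set.uIcc_of_le zero_le_one] at hx
      left; linarith [hx.1]
    refine (h1.mul_continuousOn h2).congr_uIoo ?_
    intro x hx
    rw [Set.uIoo_of_le zero_le_one] at hx
    simp only [gegenbauerWeight]
    rw [← Real.mul_rpow (by linarith [hx.2]) (by linarith [hx.1])]
    ring_nf
  have h10 := h01.comp_sub_left 0
  simp only [sub_zero, zero_sub] at h10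
  have e : (fun x => gegenbauerWeight lam (-x)) = gegenbauerWeight lam := by
    ext x; simp [gegenbauerWeight]
  rw [e] at h10
  exact h10.symm.trans h01

/-- Integration of a polynomial against the Gegenbauer weight. -/
noncomputable def weightedInt (lam : ℝ) (q : ℝ[X]) : ℝ :=
  ∫ x in (-1 : ℝ)..1, gegenbauerWeight lam x * q.eval x

lemma intervalIntegrable_weight_mul {lam : ℝ} (hlam : -(1 / 2) < lam) (q : ℝ[X]) :
    IntervalIntegrable (fun x => gegenbauerWeight lam x * q.eval x) MeasureTheory.volume (-1) 1 :=
  (intervalIntegrable_gegenbauerWeight hlam).mul_continuousOn q.continuous.continuousOn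

lemma weightedInt_add {lam : ℝ} (hlam : -(1 / 2) < lam) (p q : ℝ[X]) :
    weightedInt lam (p + q) = weightedInt lam p + weightedInt lam q := by
  simp only [weightedInt, eval_add, mul_add]
  exact intervalIntegral.integral_add (intervalIntegrable_weight_mul hlam p)
    (intervalIntegrable_weight_mul hlam q)

lemma weightedInt_C_mul (lam c : ℝ) (p : ℝ[X]) :
    weightedInt lam (C c * p) = c * weightedInt lam p := by
  simp only [weightedInt, eval_mul, eval_C]
  rw [← intervalIntegral.integral_const_mul]
  congr 1; ext x; ring

lemma weightedInt_sub {lam : ℝ} (hlam : -(1 / 2) < lam) (p q : ℝ[X]) :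
    weightedInt lam (p - q) = weightedInt lam p - weightedInt lam q := by
  rw [sub_eq_add_neg, weightedInt_add hlam, show -q = C (-1) * q by simp, weightedInt_C_mul]
  ring

lemma gegenbauerWeight_succ {lam x : ℝ} (hx : x ∈ Set.Ioo (-1 : ℝ) 1) :
    gegenbauerWeight (lam + 1) x = gegenbauerWeight lam x * (1 - x ^ 2) := by
  have : 0 < 1 - x ^ 2 := by nlinarith [hx.1, hx.2]
  simp only [gegenbauerWeight]
  rw [show lam + 1 - 1 / 2 = (lam - 1 / 2) + 1 by ring, Real.rpow_add_one this.ne']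

lemma weightedInt_succ (lam : ℝ) (q : ℝ[X]) :
    weightedInt (lam + 1) q = weightedInt lam ((1 - X ^ 2) * q) := by
  simp only [weightedInt]
  refine intervalIntegral.integral_congr_uIoo ?_
  intro x hx
  rw [Set.uIoo_of_le (by norm_num)] at hx
  simp only [gegenbauerWeight_succ hx]
  simp; ring

/-- The integrand is the derivative of (1 - x²)^(λ+1/2) q(x), which vanishes at ±1 because λ + 1/2 >
0. -/
lemma weightedInt_deriv_eq_zero {lam : ℝ} (hlam : -(1 / 2) < lam) (q : ℝ[X]) :
    weightedInt lam ((1 - X ^ 2) * derivative q - C (2 * lam + 1) * X * q) = 0 := by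
  have := intervalIntegral.integral_eq_sub_of_hasDerivAt_of_le (a := -1) (b := 1)
    (f := fun x => (1 - x ^ 2) ^ (lam + 1 / 2) * q.eval x)
    (f' := fun x => gegenbauerWeight lam x *
      ((1 - X ^ 2) * derivative q - C (2 * lam + 1) * X * q).eval x) (by norm_num)
    ?_ ?_ (intervalIntegrable_weight_mul hlam _)
  · rw [weightedInt, this]
    have h0 : lam + 1 / 2 ≠ 0 := by linarith
    norm_num [Real.zero_rpow h0]
  · refine ContinuousOn.mul ?_ q.continuous.continuousOn
    exact ContinuousOn.rpow_const (by fun_prop) fun x _ => Or.inr (by linarith)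
  · intro x hx
    have hp : 0 < 1 - x ^ 2 := by nlinarith [hx.1, hx.2]
    have h1 : HasDerivAt (fun x : ℝ => 1 - x ^ 2) (-(2 * x)) x := by
      simpa using (hasDerivAt_pow 2 x).const_sub 1
    have h2 := (h1.rpow_const (p := lam + 1 / 2) (Or.inl hp.ne')).mul (q.hasDerivAt x)
    refine h2.congr_deriv ?_
    simp only [gegenbauerWeight]
    rw [show lam + 1 / 2 - 1 = lam - 1 / 2 by ring,
      show lam + 1 / 2 = (lam - 1 / 2) + 1 by ring, Real.rpow_add_one hp.ne']
    simp
    ring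

/-- The right side is symmetric in p and q: the operator is self-adjoint for the weight. -/
lemma weightedInt_mul_gegenbauerOp {lam : ℝ} (hlam : -(1 / 2) < lam) (p q : ℝ[X]) :
    weightedInt lam (p * gegenbauerOp lam q) =
      -weightedInt (lam + 1) (derivative p * derivative q) := by
  have h := weightedInt_deriv_eq_zero hlam (p * derivative q)
  rw [weightedInt_succ, ← sub_eq_zero, sub_neg_eq_add, ← weightedInt_add hlam, ← h]
  congr 1
  simp only [gegenbauerOp, derivative_mul]
  ring

lemma weightedInt_gegenbauerPoly_mul_op {lam : ℝ} (hlam : -(1 / 2) < lam) (n : ℕ) (p : ℝ[X]) :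
    weightedInt lam (gegenbauerPoly lam n * gegenbauerOp lam p) =
      -(n * (n + 2 * lam)) * weightedInt lam (gegenbauerPoly lam n * p) := by
  rw [weightedInt_mul_gegenbauerOp hlam, mul_comm, ← weightedInt_mul_gegenbauerOp hlam,
    gegenbauerOp_gegenbauerPoly hlam, ← weightedInt_C_mul]
  congr 1; ring

/-- Integration by parts expresses the eigenvalue times the left side through derivatives. The
factor (n+1)(n+1+2λ) occurs in both the eigenvalue and the derivative formula, and cancels. -/
lemma weightedInt_gegenbauerPoly_succ {lam : ℝ} (hlam : -(1 / 2) < lam) (n : ℕ) (p : ℝ[X]) :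
    weightedInt lam (gegenbauerPoly lam (n + 1) * p) =
      1 / (2 * lam + 1) * weightedInt (lam + 1) (gegenbauerPoly (lam + 1) n * derivative p) := by
  have h := weightedInt_mul_gegenbauerOp hlam p (gegenbauerPoly lam (n + 1))
  rw [gegenbauerOp_gegenbauerPoly hlam, derivative_gegenbauerPoly hlam,
    show p * (C (-(((n + 1 : ℕ) : ℝ) * ((n + 1 : ℕ) + 2 * lam))) * gegenbauerPoly lam (n + 1)) =
      C (-(((n + 1 : ℕ) : ℝ) * ((n + 1 : ℕ) + 2 * lam))) * (gegenbauerPoly lam (n + 1) * p) by ring,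
    weightedInt_C_mul,
    show derivative p * (C ((n + 1) * (n + 1 + 2 * lam) / (2 * lam + 1)) *
      gegenbauerPoly (lam + 1) n) = C ((n + 1) * (n + 1 + 2 * lam) / (2 * lam + 1)) *
      (gegenbauerPoly (lam + 1) n * derivative p) by ring, weightedInt_C_mul] at h
  have h1 : (n : ℝ) + 1 + 2 * lam ≠ 0 := by have : (0:ℝ) ≤ n := n.cast_nonneg; linarith
  have h2 : 2 * lam + 1 ≠ 0 := by linarith
  have h3 : (n : ℝ) + 1 ≠ 0 := by positivity
  push_cast at h
  field_simp at h ⊢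
  linarith

/-- Rodrigues' formula in integrated form, by iterating the previous lemma. -/
lemma weightedInt_gegenbauerPoly (n : ℕ) : ∀ {lam : ℝ}, -(1 / 2) < lam → ∀ p : ℝ[X],
    weightedInt lam (gegenbauerPoly lam n * p) =
      1 / (2 ^ n * (ascPochhammer ℝ n).eval (lam + 1 / 2)) *
        weightedInt (lam + n) (derivative^[n] p) := by
  induction n with
  | zero => intro lam _ p; simp [gegenbauerPoly_zero]
  | succ n ih =>
    intro lam hlam p
    rw [weightedInt_gegenbauerPoly_succ hlam, ih (by linarith)]
    have key : (ascPochhammer ℝ (n + 1)).eval (lam + 1 / 2) =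
        (lam + 1 / 2) * (ascPochhammer ℝ n).eval (lam + 1 + 1 / 2) := by
      simp [ascPochhammer_succ_left, eval_comp]; left; ring_nf
    rw [key, Function.iterate_succ_apply,
      show lam + ((n + 1 : ℕ) : ℝ) = lam + 1 + n by push_cast; ring]
    have h1 : lam + 1 / 2 ≠ 0 := by linarith
    have h3 : 2 * lam + 1 ≠ 0 := by linarith
    have h2 := (ascPochhammer_eval_pos_real (show 0 < lam + 1 + 1 / 2 by linarith) n).ne'
    rw [← mul_assoc]
    congr 1
    field_simp
    ring

lemma real_beta_integral {a b : ℝ} (ha : 0 < a) (hb : 0 < b) :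
    ∫ t in (0 : ℝ)..1, t ^ (a - 1) * (1 - t) ^ (b - 1) =
      Real.Gamma a * Real.Gamma b / Real.Gamma (a + b) := by
  have h := Complex.betaIntegral_eq_Gamma_mul_div a b (by simpa) (by simpa)
  apply Complex.ofReal_injective
  rw [← intervalIntegral.integral_ofReal]
  push_cast
  rw [Complex.Gamma_ofReal, Complex.Gamma_ofReal, ← Complex.ofReal_add, Complex.Gamma_ofReal] at h
  rw [← h, Complex.betaIntegral]
  refine intervalIntegral.integral_congr_uIoo ?_
  intro x hx
  rw [Set.uIoo_of_le zero_le_one] at hx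
  simp only
  rw [Complex.ofReal_cpow hx.1.le, Complex.ofReal_cpow (by linarith [hx.2])]
  push_cast; rfl

/-- The substitution x = 2t - 1 gives a beta integral with both parameters λ + 1/2; Legendre
duplication simplifies it. -/
lemma weightedInt_one {lam : ℝ} (hlam : -(1 / 2) < lam) :
    weightedInt lam 1 =
      Real.sqrt Real.pi * Real.Gamma (lam + 1 / 2) / Real.Gamma (lam + 1) := by
  have hs : 0 < lam + 1 / 2 := by linarith
  have h1 : weightedInt lam 1 = 2 * ∫ t in (0 : ℝ)..1, gegenbauerWeight lam (2 * t - 1) := by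
    rw [intervalIntegral.integral_comp_mul_sub (fun x => gegenbauerWeight lam x) two_ne_zero]
    norm_num [weightedInt]
    ring
  have h2 : ∫ t in (0 : ℝ)..1, gegenbauerWeight lam (2 * t - 1) =
      4 ^ (lam - 1 / 2) * ∫ t in (0 : ℝ)..1,
        t ^ (lam + 1 / 2 - 1) * (1 - t) ^ (lam + 1 / 2 - 1) := by
    rw [← intervalIntegral.integral_const_mul]
    refine intervalIntegral.integral_congr_uIoo ?_
    intro x hx
    rw [Set.uIoo_of_le zero_le_one] at hx
    simp only [gegenbauerWeight]
    rw [show lam + 1 / 2 - 1 = lam - 1 / 2 by ring, ← Real.mul_rpow hx.1.le (by linarith [hx.2]),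
      ← Real.mul_rpow (by norm_num) (mul_nonneg hx.1.le (by linarith [hx.2]))]
    ring_nf
  rw [h1, h2, real_beta_integral hs hs]
  have hd := Real.Gamma_mul_Gamma_add_half (lam + 1 / 2)
  rw [show lam + 1 / 2 + 1 / 2 = lam + 1 by ring] at hd
  have g1 := (Real.Gamma_pos_of_pos hs).ne'
  have g2 := (Real.Gamma_pos_of_pos (show 0 < lam + 1 by linarith)).ne'
  rw [show lam + 1 / 2 + (lam + 1 / 2) = 2 * (lam + 1 / 2) by ring]
  have g3 := (Real.Gamma_pos_of_pos (show 0 < 2 * (lam + 1 / 2) by linarith)).ne'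
  have e1 : (4 : ℝ) ^ (lam - 1 / 2) = 2 ^ (2 * (lam - 1 / 2)) := by
    rw [Real.rpow_mul (by norm_num)]; norm_num
  have e2 : (2 : ℝ) * 2 ^ (2 * (lam - 1 / 2)) * 2 ^ (1 - 2 * (lam + 1 / 2)) = 1 := by
    nth_rewrite 1 [← Real.rpow_one 2]
    rw [← Real.rpow_add (by norm_num), ← Real.rpow_add (by norm_num)]
    ring_nf; simp
  rw [e1]
  generalize (2 : ℝ) ^ (2 * (lam - 1 / 2)) = u at *
  generalize (2 : ℝ) ^ (1 - 2 * (lam + 1 / 2)) = v at *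
  generalize Real.Gamma (lam + 1 / 2) = a at *
  generalize Real.Gamma (lam + 1) = b at *
  generalize Real.Gamma (2 * (lam + 1 / 2)) = c at *
  generalize √Real.pi = s at *
  field_simp
  linear_combination 2 * u * hd + c * s * e2

/-! ### Moments of Chebyshev polynomials against Gegenbauer polynomials -/

/-- The weighted integral of `U_m` against the normalised Gegenbauer polynomial of degree `n`. -/
noncomputable def chebyshevMoment (lam : ℝ) (n : ℕ) (m : ℤ) : ℝ :=
  weightedInt lam (gegenbauerPoly lam n * Chebyshev.U ℝ m)

/-- The difference is 2 T_{m+2}, with derivative 2(m+2) U_{m+1}, and X U_{m+1} is a combination of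
U_{m+2} and U_m. Hence only these two polynomials occur. -/
lemma gegenbauerOp_U_sub_U (lam : ℝ) (m : ℤ) :
    gegenbauerOp lam (Chebyshev.U ℝ (m + 2) - Chebyshev.U ℝ m) =
      C (-((m + 2) * (m + 2 * lam + 2) : ℝ)) * Chebyshev.U ℝ (m + 2) +
      C ((m + 2) * (m + 2 - 2 * lam) : ℝ) * Chebyshev.U ℝ m := by
  have h1 := Chebyshev.one_sub_X_sq_mul_derivative_derivative_U_eq_poly_in_U (R := ℝ) m
  have h2 := Chebyshev.one_sub_X_sq_mul_derivative_derivative_U_eq_poly_in_U (R := ℝ) (m + 2)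
  have h3 := Chebyshev.T_derivative_eq_U (R := ℝ) (m + 2)
  have h4 := congrArg derivative (Chebyshev.two_mul_T_eq_U_sub_U (R := ℝ) m)
  have h5 := Chebyshev.U_add_two ℝ m
  have e : m + 2 - 1 = m + 1 := by ring
  rw [e] at h3
  simp only [derivative_mul, derivative_ofNat, zero_mul, zero_add, derivative_sub, h3] at h4
  simp only [gegenbauerOp, derivative_sub]
  simp only [Function.iterate_succ, Function.iterate_zero, Function.comp, id] at h1 h2
  push_cast at h1 h2 h4
  simp only [C_add, C_mul, C_neg, C_sub, C_ofNat, C_1, map_intCast]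
  linear_combination h2 - h1 + (2 - 2 * C lam) * (-X) * h4 - (2 - 2 * C lam) * (m + 2) * h5

/-- Self-adjointness applied to U_{m+2} - U_m; the factors come from differences with the eigenvalue
n(n+2λ). -/
lemma chebyshevMoment_recurrence {lam : ℝ} (hlam : -(1 / 2) < lam) (n : ℕ) (m : ℤ) :
    ((m : ℝ) + 2 - n) * (m + 2 + n + 2 * lam) * chebyshevMoment lam n (m + 2) =
      (m + 2 + n) * (m + 2 - n - 2 * lam) * chebyshevMoment lam n m := by
  have h := weightedInt_gegenbauerPoly_mul_op hlam n (Chebyshev.U ℝ (m + 2) - Chebyshev.U ℝ m)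
  rw [gegenbauerOp_U_sub_U, mul_add, mul_sub (gegenbauerPoly lam n), weightedInt_add hlam,
    weightedInt_sub hlam,
    mul_left_comm, weightedInt_C_mul, mul_left_comm, weightedInt_C_mul] at h
  simp only [chebyshevMoment]
  linear_combination -h

lemma chebyshevMoment_neg_two (lam : ℝ) (n : ℕ) :
    chebyshevMoment lam n (-2) = -chebyshevMoment lam n 0 := by
  simp only [chebyshevMoment, Chebyshev.U_neg_two, Chebyshev.U_zero]
  rw [show gegenbauerPoly lam n * -1 = C (-1) * (gegenbauerPoly lam n * 1) by simp,
    weightedInt_C_mul]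
  ring

lemma chebyshevMoment_neg_one (lam : ℝ) (n : ℕ) : chebyshevMoment lam n (-1) = 0 := by
  simp [chebyshevMoment, weightedInt]

/-- The recurrence carries zero from m to m + 2 as long as m + 2 ≠ n. This covers both m < n and the
wrong parity. -/
lemma chebyshevMoment_eq_zero {lam : ℝ} (hlam : -(1 / 2) < lam) (n m : ℕ)
    (h : ∀ j, m ≠ n + 2 * j) : chebyshevMoment lam n m = 0 := by
  have hpos : ∀ m : ℕ, m ≠ n → (m : ℝ) + n + 2 * lam ≠ 0 := by
    intro m hm
    have : (1 : ℝ) ≤ m + n := by exact_mod_cast (show 1 ≤ m + n by omega)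
    linarith
  have hsub : ∀ m : ℕ, m ≠ n → (m : ℝ) - n ≠ 0 := by
    intro m hm; rw [sub_ne_zero]; exact_mod_cast hm
  induction m using Nat.strong_induction_on with
  | _ m ih =>
    have hm : m ≠ n := by simpa using h 0
    have p1 := hpos m hm
    have p2 := hsub m hm
    match m, ih with
    | 0, _ =>
      -- Since U_{-2} = -U_0, the recurrence at -2 relates the moment of U_0 to itself and reads
      -- -2n(n+2λ) μ_0 = 0.
      have hr := chebyshevMoment_recurrence hlam n (-2)
      rw [chebyshevMoment_neg_two] at hr
      have : ((0 : ℕ) - n : ℝ) * ((0 : ℕ) + n + 2 * lam) * chebyshevMoment lam n 0 = 0 := by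
        norm_num at hr ⊢
        rcases hr with (h | h) | h
        · left; right; linarith
        · simp [h]
        · simp [h]
      rw [Nat.cast_zero]
      simpa only [p1, p2, mul_eq_zero, false_or] using this
    | 1, _ =>
      have hr := chebyshevMoment_recurrence hlam n (-1)
      rw [chebyshevMoment_neg_one] at hr
      norm_num at hr p1 p2 ⊢
      rcases hr with (h | h) | h
      · exact absurd h p2
      · exact absurd h p1
      · exact h
    | m + 2, ih =>
      have hr := chebyshevMoment_recurrence hlam n m
      have h0 := ih m (by omega) fun j hj => h (j + 1) (by omega)
      rw [h0, mul_zero] at hr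
      push_cast at hr p1 p2 ⊢
      simpa [p1, p2] using hr

/-- The coefficients of `₂F₁(n + 1, 1 - lam; n + lam + 1; X)`. -/
noncomputable def connCoeff (lam : ℝ) (n j : ℕ) : ℝ :=
  (ascPochhammer ℝ j).eval ((n : ℝ) + 1) * (ascPochhammer ℝ j).eval (1 - lam) /
    ((ascPochhammer ℝ j).eval ((n : ℝ) + lam + 1) * j.factorial)

lemma connCoeff_zero (lam : ℝ) (n : ℕ) : connCoeff lam n 0 = 1 := by simp [connCoeff]

lemma connCoeff_succ {lam : ℝ} (hlam : -(1 / 2) < lam) (n j : ℕ) :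
    connCoeff lam n (j + 1) =
      (n + 1 + j) * (1 - lam + j) / ((n + lam + 1 + j) * (j + 1)) * connCoeff lam n j := by
  have hp : 0 < (n : ℝ) + lam + 1 := by have : (0:ℝ) ≤ n := n.cast_nonneg; linarith
  have h1 := (ascPochhammer_eval_pos_real hp j).ne'
  have h2 : (n : ℝ) + lam + 1 + j ≠ 0 := by positivity
  have h3 : ((j.factorial : ℕ) : ℝ) ≠ 0 := by positivity
  simp only [connCoeff, ascPochhammer_succ_eval, Nat.factorial_succ]
  push_cast
  field_simp

/-- From m = n upwards the recurrence is, after division by 4, the ratio of consecutive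
hypergeometric coefficients. -/
lemma chebyshevMoment_add_two_mul {lam : ℝ} (hlam : -(1 / 2) < lam) (n j : ℕ) :
    chebyshevMoment lam n ((n + 2 * j : ℕ) : ℤ) =
      connCoeff lam n j * chebyshevMoment lam n n := by
  induction j with
  | zero => simp [connCoeff_zero]
  | succ j ih =>
    have hr := chebyshevMoment_recurrence hlam n ((n + 2 * j : ℕ) : ℤ)
    have hp : 0 < (n : ℝ) + lam + 1 := by have : (0:ℝ) ≤ n := n.cast_nonneg; linarith
    have h2 : (n : ℝ) + lam + 1 + j ≠ 0 := by positivity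
    rw [ih] at hr
    rw [connCoeff_succ hlam, show ((n + 2 * (j + 1) : ℕ) : ℤ) = ((n + 2 * j : ℕ) : ℤ) + 2 by
      push_cast; ring]
    have h3 : (j : ℝ) + 1 ≠ 0 := by positivity
    push_cast at hr ⊢
    field_simp
    linear_combination hr / 4

/-- By Rodrigues only the n-th derivative of U_n matters: it is the constant 2^n n!, and the total
mass of the weight with parameter λ + n remains. -/
lemma chebyshevMoment_self {lam : ℝ} (hlam : -(1 / 2) < lam) (n : ℕ) :
    chebyshevMoment lam n n = n.factorial * Real.sqrt Real.pi * Real.Gamma (lam + 1 / 2) /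
      Real.Gamma (lam + n + 1) := by
  have hd : derivative^[n] (Chebyshev.U ℝ n) = C ((2 : ℝ) ^ n * n.factorial) * 1 := by
    have h1 : (derivative^[n] (Chebyshev.U ℝ n)).natDegree = 0 := by
      have := natDegree_iterate_derivative (Chebyshev.U ℝ n) n
      simpa [Chebyshev.natDegree_U_natCast] using this
    rw [eq_C_of_natDegree_eq_zero h1, coeff_iterate_derivative, mul_one]
    congr 1
    have := Chebyshev.leadingCoeff_U_natCast ℝ n
    rw [leadingCoeff, Chebyshev.natDegree_U_natCast] at this
    simp [this, Nat.descFactorial_self, mul_comm]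
  have hn : (0 : ℝ) ≤ n := n.cast_nonneg
  rw [chebyshevMoment, weightedInt_gegenbauerPoly n hlam, hd, weightedInt_C_mul,
    weightedInt_one (by linarith)]
  have hg : Real.Gamma (lam + n + 1 / 2) =
      (ascPochhammer ℝ n).eval (lam + 1 / 2) * Real.Gamma (lam + 1 / 2) := by
    clear hd
    induction n with
    | zero => simp
    | succ n ih =>
      have hn : (0 : ℝ) ≤ n := n.cast_nonneg
      rw [ascPochhammer_succ_eval, show lam + ((n + 1 : ℕ) : ℝ) + 1 / 2 = lam + n + 1 / 2 + 1 by
        push_cast; ring, Real.Gamma_add_one (by linarith), ih hn]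
      ring
  rw [hg, one_div]
  have h2 := (ascPochhammer_eval_pos_real (show 0 < lam + 1 / 2 by linarith) n).ne'
  generalize (ascPochhammer ℝ n).eval (lam + 1 / 2) = t at *
  field_simp

lemma Gamma_two_mul_ne_zero {lam : ℝ} (hlam : -(1 / 2) < lam) (hlam0 : lam ≠ 0) (n : ℕ) :
    Real.Gamma (n + 2 * lam) ≠ 0 := by
  refine Real.Gamma_ne_zero fun m hm => ?_
  rcases Nat.eq_zero_or_pos (n + m) with h | h
  · have h1 : n = 0 := by omega
    have h2 : m = 0 := by omega
    subst h1 h2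
    simp at hm; exact hlam0 hm
  · have : (1 : ℝ) ≤ n + m := by exact_mod_cast h
    linarith

lemma Gamma_nat_add_ne_zero {lam : ℝ} (hlam : -(1 / 2) < lam) (hlam0 : lam ≠ 0) (n : ℕ) :
    Real.Gamma (n + lam) ≠ 0 := by
  refine Real.Gamma_ne_zero fun m hm => ?_
  rcases Nat.eq_zero_or_pos (n + m) with h | h
  · have h1 : n = 0 := by omega
    have h2 : m = 0 := by omega
    subst h1 h2
    simp at hm; exact hlam0 hm
  · have : (1 : ℝ) ≤ n + m := by exact_mod_cast h
    linarith

lemma nat_add_ne_zero {lam : ℝ} (hlam : -(1 / 2) < lam) (hlam0 : lam ≠ 0) (n : ℕ) :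
    (n : ℝ) + lam ≠ 0 := by
  rcases Nat.eq_zero_or_pos n with h | h
  · simpa [h]
  · have : (1 : ℝ) ≤ n := by exact_mod_cast h
    linarith

/-- The constant `Γ(lam) n! / Γ(n + lam)` relating `U_n` to `C_n^lam`. -/
noncomputable def connConst (lam : ℝ) (n : ℕ) : ℝ :=
  Real.Gamma lam * n.factorial / Real.Gamma (n + lam)

lemma chebyshevMoment_div_gegenbauerH {lam : ℝ} (hlam : -(1 / 2) < lam) (hlam0 : lam ≠ 0) (n : ℕ) :
    1 / gegenbauerH lam n *
      ((ascPochhammer ℝ n).eval (2 * lam) / n.factorial * chebyshevMoment lam n n) =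
      connConst lam n := by
  have h0 := Gamma_two_mul_ne_zero hlam hlam0 0
  have h1 := Gamma_two_mul_ne_zero hlam hlam0 n
  have h2 : Real.Gamma lam ≠ 0 := by simpa using Gamma_nat_add_ne_zero hlam hlam0 0
  have h2' := Gamma_nat_add_ne_zero hlam hlam0 n
  have h3 := nat_add_ne_zero hlam hlam0 n
  have h5 := Real.pi_ne_zero
  have h6 : (2 : ℝ) ^ (1 - 2 * lam) ≠ 0 := (Real.rpow_pos_of_pos two_pos _).ne'
  have hd := Real.Gamma_mul_Gamma_add_half lam
  have h7 : ((n.factorial : ℕ) : ℝ) ≠ 0 := by positivity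
  have hp : Real.Gamma (n + 2 * lam) = (ascPochhammer ℝ n).eval (2 * lam) * Real.Gamma (2 * lam) := by
    clear h1 h2' h3 h7
    induction n with
    | zero => simp
    | succ n ih =>
      have h := Gamma_two_mul_ne_zero hlam hlam0 n
      have hz : (n : ℝ) + 2 * lam ≠ 0 := by
        rcases Nat.eq_zero_or_pos n with h | h
        · simpa [h]
        · have : (1 : ℝ) ≤ n := by exact_mod_cast h
          linarith
      rw [ascPochhammer_succ_eval, show ((n + 1 : ℕ) : ℝ) + 2 * lam = n + 2 * lam + 1 by
        push_cast; ring, Real.Gamma_add_one hz, ih]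
      ring
  rw [chebyshevMoment_self hlam, gegenbauerH, connConst, Real.Gamma_nat_eq_factorial,
    show lam + n + 1 = n + lam + 1 by ring, Real.Gamma_add_one h3, hp]
  have hsq : √Real.pi * √Real.pi = Real.pi := Real.mul_self_sqrt Real.pi_pos.le
  have hg : Real.Gamma (lam + 1 / 2) =
    Real.Gamma (2 * lam) * 2 ^ (1 - 2 * lam) * √Real.pi / Real.Gamma lam := by
    rw [← hd]; field_simp
  simp only [Nat.cast_zero, zero_add] at h0
  have h8 : (ascPochhammer ℝ n).eval (2 * lam) ≠ 0 := by
    intro h; rw [h, zero_mul] at hp; exact h1 hp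
  rw [hg]
  have h9 : √Real.pi ≠ 0 := by intro h; rw [h] at hsq; simp at hsq; exact h5 hsq.symm
  generalize (2 : ℝ) ^ (1 - 2 * lam) = u at *
  generalize Real.Gamma (2 * lam) = c at *
  generalize Real.Gamma lam = d at *
  generalize Real.Gamma (n + lam) = d' at *
  generalize √Real.pi = s at *
  rw [← hsq]
  field_simp

/-! ### Binomial series and bounds for the hypergeometric factor -/

lemma choose_add_sub_one_eq (a : ℂ) (n : ℕ) :
    Ring.choose (a + n - 1) n = (ascPochhammer ℂ n).eval a / n.factorial := by
  have h : Ring.choose (a + n - 1) n = Ring.multichoose a n := by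
    rw [Ring.choose]; congr 1; ring
  have h2 := Ring.factorial_nsmul_multichoose_eq_ascPochhammer a n
  rw [h, eq_div_iff (by exact_mod_cast n.factorial_ne_zero)]
  rw [← ascPochhammer_smeval_eq_eval, ← h2, nsmul_eq_mul, mul_comm]

lemma ofReal_ascPochhammer_eval (a : ℝ) (n : ℕ) :
    (((ascPochhammer ℝ n).eval a : ℝ) : ℂ) = (ascPochhammer ℂ n).eval (a : ℂ) := by
  induction n with
  | zero => simp
  | succ n ih => simp [ascPochhammer_succ_eval, ih]

lemma hasSum_binomial_complex (a : ℝ) {z : ℂ} (hz : ‖z‖ < 1) :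
    HasSum (fun j : ℕ => (((ascPochhammer ℝ j).eval a / j.factorial : ℝ) : ℂ) * z ^ j)
      ((1 - z) ^ ((-a : ℝ) : ℂ)) := by
  have h := (Complex.one_div_one_sub_cpow_hasFPowerSeriesOnBall_zero (a : ℂ)).hasSum (y := z)
    (by simpa [← ENNReal.ofReal_one, Metric.eball_ofReal] using hz)
  simp only [FormalMultilinearSeries.ofScalars_apply_eq, choose_add_sub_one_eq, zero_add] at h
  rw [Complex.ofReal_neg, Complex.cpow_neg, ← one_div]
  refine h.congr_fun fun j => ?_
  push_cast [ofReal_ascPochhammer_eval]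
  simp

lemma hasSum_binomial_real (a : ℝ) {r : ℝ} (h0 : 0 ≤ r) (h1 : r < 1) :
    HasSum (fun j : ℕ => (ascPochhammer ℝ j).eval a / j.factorial * r ^ j)
      ((1 - r) ^ (-a)) := by
  have h := hasSum_binomial_complex a (z := (r : ℂ)) (by simpa [abs_of_nonneg h0] using h1)
  rw [← Complex.hasSum_ofReal]
  convert h using 1
  · ext j; push_cast; rfl
  · rw [Complex.ofReal_cpow (by linarith)]; push_cast; rfl

lemma abs_ascPochhammer_eval_le (lam : ℝ) (j : ℕ) :
    |(ascPochhammer ℝ j).eval (1 - lam)| ≤ (ascPochhammer ℝ j).eval (1 + |lam|) := by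
  induction j with
  | zero => simp
  | succ j ih =>
    rw [ascPochhammer_succ_eval, ascPochhammer_succ_eval, abs_mul]
    refine mul_le_mul ih ?_ (abs_nonneg _) (ascPochhammer_eval_pos_real (by positivity) j).le
    rw [abs_le]
    have := neg_abs_le lam
    have := le_abs_self lam
    constructor <;> linarith [(j.cast_nonneg : (0 : ℝ) ≤ j)]

lemma summable_abs_binomial (lam : ℝ) {r : ℝ} (h0 : 0 ≤ r) (h1 : r < 1) :
    Summable (fun j : ℕ => |(ascPochhammer ℝ j).eval (1 - lam)| / j.factorial * r ^ j) := by
  refine Summable.of_nonneg_of_le (fun j => by positivity) (fun j => ?_)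
    (hasSum_binomial_real (1 + |lam|) h0 h1).summable
  gcongr
  exact abs_ascPochhammer_eval_le lam j

lemma ascPochhammer_mul_Gamma {a : ℝ} (ha : 0 < a) (j : ℕ) :
    (ascPochhammer ℝ j).eval a * Real.Gamma a = Real.Gamma (a + j) := by
  induction j with
  | zero => simp
  | succ j ih =>
    rw [ascPochhammer_succ_eval, Nat.cast_succ, ← add_assoc,
      Real.Gamma_add_one (by positivity), ← ih]
    ring

/-- Bound for `₂F₁(n + 1, 1 - lam; n + lam + 1; ·)` on the disc of radius `r`. -/
noncomputable def connBound (lam r : ℝ) : ℝ :=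
  if lam < 0 then
    Real.Gamma (1 + lam) * Real.Gamma (1 - 2 * lam) / Real.Gamma (1 - lam) * (1 - r) ^ (2 * lam - 1)
  else if lam ≤ 1 then (1 - r) ^ (lam - 1)
  else (1 + r) ^ (lam - 1)

lemma connCoeff_nonneg {lam : ℝ} (hlam : -(1 / 2) < lam) (hneg : lam < 0) (n j : ℕ) :
    0 ≤ connCoeff lam n j := by
  have hn : (0 : ℝ) ≤ n := n.cast_nonneg
  have h1 := ascPochhammer_eval_pos_real (show (0 : ℝ) < n + 1 by positivity) j
  have h2 := ascPochhammer_eval_pos_real (show (0 : ℝ) < 1 - lam by linarith) j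
  have h3 := ascPochhammer_eval_pos_real (show (0 : ℝ) < n + lam + 1 by linarith) j
  simp only [connCoeff]; positivity

/-- For λ < 0 the quotient (n+1+j)/(n+1+j+λ) decreases in n, so each ratio of consecutive
coefficients is largest at n = 0. -/
lemma connCoeff_le_connCoeff_zero {lam : ℝ} (hlam : -(1 / 2) < lam) (hneg : lam < 0) (n j : ℕ) :
    connCoeff lam n j ≤ connCoeff lam 0 j := by
  induction j with
  | zero => simp [connCoeff_zero]
  | succ j ih =>
    rw [connCoeff_succ hlam, connCoeff_succ hlam]
    have hn : (0 : ℝ) ≤ n := n.cast_nonneg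
    have hj : (0 : ℝ) ≤ j := j.cast_nonneg
    have p1 : (0 : ℝ) < n + lam + 1 + j := by linarith
    have p2 : (0 : ℝ) < lam + 1 + j := by linarith
    have p3 : (0 : ℝ) < 1 - lam + j := by linarith
    refine mul_le_mul ?_ ih (connCoeff_nonneg hlam hneg n j) ?_
    · rw [Nat.cast_zero, zero_add, zero_add, div_le_div_iff₀ (by positivity) (by positivity)]
      have : ((n : ℝ) + 1 + j) * (lam + 1 + j) ≤ (1 + j) * (n + lam + 1 + j) := by nlinarith
      nlinarith [mul_le_mul_of_nonneg_left this (show 0 ≤ (1 - lam + j) * ((j : ℝ) + 1) by positivity)]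
    · rw [Nat.cast_zero, zero_add, zero_add]; positivity

/-- Log-convexity of Γ at the two points dividing [s, s+3d] into thirds. -/
lemma Gamma_mul_Gamma_le {s d : ℝ} (hs : 0 < s) (hd : 0 < d) :
    Real.Gamma (s + d) * Real.Gamma (s + 2 * d) ≤ Real.Gamma s * Real.Gamma (s + 3 * d) := by
  have h1 := Real.Gamma_mul_add_mul_le_rpow_Gamma_mul_rpow_Gamma (s := s) (t := s + 3 * d)
    (a := 2 / 3) (b := 1 / 3) hs (by linarith) (by norm_num) (by norm_num) (by norm_num)
  have h2 := Real.Gamma_mul_add_mul_le_rpow_Gamma_mul_rpow_Gamma (s := s) (t := s + 3 * d)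
    (a := 1 / 3) (b := 2 / 3) hs (by linarith) (by norm_num) (by norm_num) (by norm_num)
  rw [show 2 / 3 * s + 1 / 3 * (s + 3 * d) = s + d by ring] at h1
  rw [show 1 / 3 * s + 2 / 3 * (s + 3 * d) = s + 2 * d by ring] at h2
  have g1 := Real.Gamma_pos_of_pos hs
  have g2 := Real.Gamma_pos_of_pos (show 0 < s + 3 * d by linarith)
  have g3 := Real.Gamma_pos_of_pos (show 0 < s + 2 * d by linarith)
  refine (mul_le_mul h1 h2 g3.le (by positivity)).trans_eq ?_
  rw [mul_mul_mul_comm, ← Real.rpow_add g1, ← Real.rpow_add g2]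
  norm_num

/-- The majorant is a multiple of the coefficients of (1 - r)^(2λ-1), so it can be summed in closed
form. -/
lemma connCoeff_le {lam : ℝ} (hlam : -(1 / 2) < lam) (hneg : lam < 0) (n j : ℕ) :
    connCoeff lam n j ≤ Real.Gamma (1 + lam) * Real.Gamma (1 - 2 * lam) / Real.Gamma (1 - lam) *
      ((ascPochhammer ℝ j).eval (1 - 2 * lam) / j.factorial) := by
  refine (connCoeff_le_connCoeff_zero hlam hneg n j).trans ?_
  have p1 : (0 : ℝ) < 1 + lam := by linarith
  have p2 : (0 : ℝ) < 1 - lam := by linarith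
  have p3 : (0 : ℝ) < 1 - 2 * lam := by linarith
  have hj : (0 : ℝ) ≤ j := j.cast_nonneg
  have a1 := ascPochhammer_mul_Gamma p1 j
  have a2 := ascPochhammer_mul_Gamma p2 j
  have a3 := ascPochhammer_mul_Gamma p3 j
  have g1 := Real.Gamma_pos_of_pos p1
  have g2 := Real.Gamma_pos_of_pos p2
  -- At n = 0 the coefficient is (1-λ)_j/(1+λ)_j. The points 1+λ+j, 1+j, 1-λ+j, 1-2λ+j are equally
  -- spaced by -λ > 0.
  have h := Gamma_mul_Gamma_le (s := 1 + lam + j) (d := -lam) (by linarith) (by linarith)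
  rw [show 1 + lam + j + -lam = j + 1 by ring, show 1 + lam + j + 2 * -lam = 1 - lam + j by ring,
    show 1 + lam + j + 3 * -lam = 1 - 2 * lam + j by ring, ← a1, ← a2, ← a3,
    Real.Gamma_nat_eq_factorial] at h
  have e1 : (ascPochhammer ℝ j).eval (1 : ℝ) = j.factorial := by
    simp [ascPochhammer_eval_one]
  have q1 := ascPochhammer_eval_pos_real p1 j
  have hf : (0 : ℝ) < j.factorial := by positivity
  simp only [connCoeff, Nat.cast_zero, zero_add, e1]
  rw [add_comm lam 1, div_mul_div_comm, div_le_div_iff₀ (by positivity) (by positivity)]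
  nlinarith [mul_le_mul_of_nonneg_left h hf.le]

lemma abs_connCoeff_le_of_pos {lam : ℝ} (hpos : 0 < lam) (n j : ℕ) :
    |connCoeff lam n j| ≤ |(ascPochhammer ℝ j).eval (1 - lam)| / j.factorial := by
  have h1 := ascPochhammer_eval_pos_real (show (0 : ℝ) < n + 1 by positivity) j
  have h3 := ascPochhammer_eval_pos_real (show (0 : ℝ) < n + lam + 1 by positivity) j
  have h : (ascPochhammer ℝ j).eval ((n : ℝ) + 1) ≤ (ascPochhammer ℝ j).eval ((n : ℝ) + lam + 1) := by
    clear h1 h3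
    induction j with
    | zero => simp
    | succ j ih =>
      rw [ascPochhammer_succ_eval, ascPochhammer_succ_eval]
      refine mul_le_mul ih (by linarith) (by positivity)
        (ascPochhammer_eval_pos_real (by positivity) j).le
  rw [connCoeff, abs_div, abs_mul, abs_mul, abs_of_pos h1, abs_of_pos h3, Nat.abs_cast]
  rw [div_le_div_iff₀ (by positivity) (by positivity)]
  nlinarith [mul_le_mul_of_nonneg_right h (show 0 ≤ |(ascPochhammer ℝ j).eval (1 - lam)| *
    (j.factorial : ℝ) by positivity)]

lemma summable_connCoeff {lam : ℝ} (hlam : -(1 / 2) < lam) (hlam0 : lam ≠ 0) (n : ℕ) {r : ℝ}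
    (h0 : 0 ≤ r) (h1 : r < 1) : Summable (fun j : ℕ => |connCoeff lam n j| * r ^ j) := by
  rcases lt_or_gt_of_ne hlam0 with h | h
  · refine Summable.of_nonneg_of_le (fun j => by positivity) (fun j => ?_)
      ((hasSum_binomial_real (1 - 2 * lam) h0 h1).summable.mul_left
        (Real.Gamma (1 + lam) * Real.Gamma (1 - 2 * lam) / Real.Gamma (1 - lam)))
    rw [abs_of_nonneg (connCoeff_nonneg hlam h n j), ← mul_assoc]
    exact mul_le_mul_of_nonneg_right (connCoeff_le hlam h n j) (by positivity)
  · refine Summable.of_nonneg_of_le (fun j => by positivity) (fun j => ?_)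
      (summable_abs_binomial lam h0 h1)
    exact mul_le_mul_of_nonneg_right (abs_connCoeff_le_of_pos h n j) (by positivity)

/-- The quotient (n+1)_j/(n+λ+1)_j is the j-th moment of the beta law with parameters n + 1 and λ.
-/
lemma connCoeff_mul_beta {lam : ℝ} (hpos : 0 < lam) (n j : ℕ) :
    connCoeff lam n j * (∫ t in (0 : ℝ)..1, t ^ n * (1 - t) ^ (lam - 1)) =
      (ascPochhammer ℝ j).eval (1 - lam) / j.factorial *
        ∫ t in (0 : ℝ)..1, t ^ n * (1 - t) ^ (lam - 1) * t ^ j := by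
  have hb : ∀ m : ℕ, ∫ t in (0 : ℝ)..1, t ^ m * (1 - t) ^ (lam - 1) =
      Real.Gamma (m + 1) * Real.Gamma lam / Real.Gamma (m + 1 + lam) := by
    intro m
    rw [← real_beta_integral (by positivity) hpos]
    simp
  have e : ∀ t : ℝ, t ^ n * (1 - t) ^ (lam - 1) * t ^ j = t ^ (n + j) * (1 - t) ^ (lam - 1) := by
    intro t; rw [pow_add]; ring
  simp only [e, hb]
  have p1 : (0 : ℝ) < n + 1 := by positivity
  have p2 : (0 : ℝ) < n + lam + 1 := by positivity
  have a1 := ascPochhammer_mul_Gamma p1 j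
  have a2 := ascPochhammer_mul_Gamma p2 j
  have g2 := (Real.Gamma_pos_of_pos p2).ne'
  have q2 := (ascPochhammer_eval_pos_real p2 j).ne'
  have hf : ((j.factorial : ℕ) : ℝ) ≠ 0 := by positivity
  push_cast
  rw [show (n : ℝ) + j + 1 + lam = n + lam + 1 + j by ring,
    show (n : ℝ) + j + 1 = n + 1 + j by ring, show (n : ℝ) + 1 + lam = n + lam + 1 by ring,
    ← a1, ← a2, connCoeff]
  field_simp

/-- Euler's integral: the series is the mean of (1 - xt)^(λ-1) under the beta law proportional to
t^n (1-t)^(λ-1), so a bound on the modulus of the integrand passes to the sum, uniformly in n. -/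
lemma norm_tsum_connCoeff_le_of_pos {lam : ℝ} (hpos : 0 < lam) (n : ℕ) {x : ℂ} (hx : ‖x‖ < 1)
    {B : ℝ} (hB : ∀ t ∈ Set.Ioo (0 : ℝ) 1, ‖1 - x * t‖ ^ (lam - 1) ≤ B) :
    ‖∑' j, (connCoeff lam n j : ℂ) * x ^ j‖ ≤ B := by
  set W : ℝ → ℝ := fun t => t ^ n * (1 - t) ^ (lam - 1) with hW
  have hint : ∀ g : ℝ → ℝ, Continuous g →
      IntervalIntegrable (fun t => W t * g t) MeasureTheory.volume 0 1 := by
    intro g hg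
    have h1 : IntervalIntegrable (fun x : ℝ => (1 - x) ^ (lam - 1)) MeasureTheory.volume 0 1 := by
      have := (intervalIntegral.intervalIntegrable_rpow' (a := 0) (b := 1)
        (r := lam - 1) (by linarith)).comp_sub_left 1
      simpa using this.symm
    have h2 := h1.mul_continuousOn (g := fun t => t ^ n * g t) (by fun_prop)
    refine h2.congr_uIoo fun t _ => ?_
    simp only [hW]; ring
  have hWi : IntervalIntegrable W MeasureTheory.volume 0 1 := by
    simpa using hint (fun _ => 1) continuous_const
  set I := ∫ t in (0 : ℝ)..1, W t with hI
  have hIpos : 0 < I := by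
    have := real_beta_integral (a := n + 1) (by positivity) hpos
    simp only [add_sub_cancel_right, Real.rpow_natCast] at this
    rw [hI, hW]; simp only
    rw [this]
    have g1 := Real.Gamma_pos_of_pos (show (0 : ℝ) < n + 1 by positivity)
    have g2 := Real.Gamma_pos_of_pos hpos
    have g3 := Real.Gamma_pos_of_pos (show (0 : ℝ) < n + 1 + lam by positivity)
    positivity
  have hWnn : ∀ t ∈ Set.Ioo (0 : ℝ) 1, 0 ≤ W t := fun t ht =>
    mul_nonneg (pow_nonneg ht.1.le _) (Real.rpow_nonneg (by linarith [ht.2]) _)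
  set p : ℕ → ℝ := fun j => (ascPochhammer ℝ j).eval (1 - lam) / j.factorial with hp
  have hsum : HasSum (fun j => ∫ t in (0 : ℝ)..1, ((W t : ℝ) : ℂ) * ((p j : ℂ) * (x * t) ^ j))
      (∫ t in (0 : ℝ)..1, (W t : ℂ) * (1 - x * t) ^ ((-(1 - lam) : ℝ) : ℂ)) := by
    refine intervalIntegral.hasSum_integral_of_dominated_convergence
      (fun j t => W t * (|(ascPochhammer ℝ j).eval (1 - lam)| / j.factorial * ‖x‖ ^ j)) ?_ ?_ ?_ ?_ ?_
    · intro j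
      have h := (hint (fun t => 1) continuous_const).1.aestronglyMeasurable
      rw [Set.uIoc_of_le zero_le_one]
      refine (Complex.continuous_ofReal.comp_aestronglyMeasurable ?_).mul
        (Continuous.aestronglyMeasurable (by fun_prop))
      simpa using h
    · intro j
      filter_upwards [MeasureTheory.Measure.ae_ne MeasureTheory.volume (1 : ℝ)] with t ht1 ht
      rw [Set.uIoc_of_le zero_le_one] at ht
      have ht' : t ∈ Set.Ioo (0 : ℝ) 1 := ⟨ht.1, lt_of_le_of_ne ht.2 ht1⟩
      rw [norm_mul, Complex.norm_real, Real.norm_of_nonneg (hWnn t ht')]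
      refine mul_le_mul_of_nonneg_left ?_ (hWnn t ht')
      rw [norm_mul, Complex.norm_real, norm_pow, norm_mul, Complex.norm_real, Real.norm_eq_abs,
        Real.norm_of_nonneg ht.1.le, hp]
      simp only [abs_div, Nat.abs_cast]
      refine mul_le_mul_of_nonneg_left ?_ (by positivity)
      exact pow_le_pow_left₀ (by have := ht.1; positivity)
        (mul_le_of_le_one_right (norm_nonneg _) ht.2) _
    · refine Filter.Eventually.of_forall fun t _ => ?_
      exact (summable_abs_binomial lam (norm_nonneg x) hx).mul_left _
    · simp only [tsum_mul_left]
      exact hWi.mul_const _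
    · refine Filter.Eventually.of_forall fun t ht => ?_
      rw [Set.uIoc_of_le zero_le_one] at ht
      refine (hasSum_binomial_complex (1 - lam) ?_).mul_left _
      rw [norm_mul, Complex.norm_real, Real.norm_of_nonneg ht.1.le]
      exact (mul_le_of_le_one_right (norm_nonneg _) ht.2).trans_lt hx
  have hterm : ∀ j, ∫ t in (0 : ℝ)..1, ((W t : ℝ) : ℂ) * ((p j : ℂ) * (x * t) ^ j) =
      (I : ℂ) * ((connCoeff lam n j : ℂ) * x ^ j) := by
    intro j
    have h := connCoeff_mul_beta hpos n j
    have h' := congrArg (fun r : ℝ => (r : ℂ)) h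
    simp only [Complex.ofReal_mul] at h'
    calc _ = ∫ t in (0 : ℝ)..1, ((p j : ℂ) * x ^ j) * ((W t * t ^ j : ℝ) : ℂ) := by
          congr 1; ext t; push_cast; ring
      _ = ((p j : ℂ) * x ^ j) * ((∫ t in (0 : ℝ)..1, W t * t ^ j : ℝ) : ℂ) := by
          rw [intervalIntegral.integral_const_mul, intervalIntegral.integral_ofReal]
      _ = _ := by
          rw [hI]
          linear_combination -(x ^ j) * h'
  simp only [hterm] at hsum
  have hI' : (I : ℂ) ≠ 0 := by exact_mod_cast hIpos.ne'
  rw [← mul_le_mul_iff_right₀ hIpos]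
  have e : I * ‖∑' j, (connCoeff lam n j : ℂ) * x ^ j‖ =
      ‖∫ t in (0 : ℝ)..1, (W t : ℂ) * (1 - x * t) ^ ((-(1 - lam) : ℝ) : ℂ)‖ := by
    rw [← hsum.tsum_eq, tsum_mul_left, norm_mul, Complex.norm_real, Real.norm_of_nonneg hIpos.le]
  rw [e, hI, ← intervalIntegral.integral_mul_const]
  refine intervalIntegral.norm_integral_le_of_norm_le zero_le_one ?_ (hWi.mul_const _)
  filter_upwards [MeasureTheory.Measure.ae_ne MeasureTheory.volume (1 : ℝ)] with t ht1 ht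
  have ht' : t ∈ Set.Ioo (0 : ℝ) 1 := ⟨ht.1, lt_of_le_of_ne ht.2 ht1⟩
  rw [norm_mul, Complex.norm_real, Real.norm_of_nonneg (hWnn t ht'), Complex.norm_cpow_real]
  refine mul_le_mul_of_nonneg_left ?_ (hWnn t ht')
  rw [neg_sub]
  exact hB t ht'

/-- For λ < 0 the beta density is not integrable at 1, so the positive coefficients are majorised
termwise. For λ > 0, Euler's integral is used with 1 - |x| ≤ |1 - xt| ≤ 1 + |x|; the sign of λ - 1
decides which side matters. -/
lemma norm_tsum_connCoeff_le {lam : ℝ} (hlam : -(1 / 2) < lam) (hlam0 : lam ≠ 0) (n : ℕ) {x : ℂ}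
    (hx : ‖x‖ < 1) : ‖∑' j, (connCoeff lam n j : ℂ) * x ^ j‖ ≤ connBound lam ‖x‖ := by
  have ht1 : ∀ t ∈ Set.Ioo (0 : ℝ) 1, ‖x * t‖ ≤ ‖x‖ := by
    intro t ht
    rw [norm_mul, Complex.norm_real, Real.norm_of_nonneg ht.1.le]
    exact mul_le_of_le_one_right (norm_nonneg _) ht.2.le
  rcases lt_or_gt_of_ne hlam0 with h | h
  · rw [connBound, if_pos h]
    have hs := summable_connCoeff hlam hlam0 n (norm_nonneg x) hx
    have hb := (hasSum_binomial_real (1 - 2 * lam) (norm_nonneg x) hx).mul_left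
        (Real.Gamma (1 + lam) * Real.Gamma (1 - 2 * lam) / Real.Gamma (1 - lam))
    rw [neg_sub] at hb
    rw [← hb.tsum_eq]
    have e : ∀ j, ‖(connCoeff lam n j : ℂ) * x ^ j‖ = |connCoeff lam n j| * ‖x‖ ^ j := by
      intro j; rw [norm_mul, norm_pow, Complex.norm_real, Real.norm_eq_abs]
    refine (norm_tsum_le_tsum_norm (by simpa only [e] using hs)).trans ?_
    simp only [e]
    refine hs.tsum_le_tsum (fun j => ?_) hb.summable
    rw [abs_of_nonneg (connCoeff_nonneg hlam h n j), ← mul_assoc]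
    exact mul_le_mul_of_nonneg_right (connCoeff_le hlam h n j) (by positivity)
  · refine norm_tsum_connCoeff_le_of_pos h n hx fun t ht => ?_
    rw [connBound, if_neg (not_lt.2 h.le)]
    have l1 : 1 - ‖x‖ ≤ ‖1 - x * t‖ := by
      have := norm_sub_norm_le (1 : ℂ) (x * t)
      rw [norm_one] at this
      linarith [ht1 t ht]
    have l2 : ‖1 - x * t‖ ≤ 1 + ‖x‖ := by
      have := norm_sub_le (1 : ℂ) (x * t)
      rw [norm_one] at this
      linarith [ht1 t ht]
    split_ifs with h1
    · exact Real.rpow_le_rpow_of_nonpos (by linarith) l1 (by linarith)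
    · exact Real.rpow_le_rpow (norm_nonneg _) l2 (by linarith)

/-! ### Bounds for the gamma quotient -/

/-- Log-convexity of Γ, with x + 1 lying between x and x + λ. -/
lemma Gamma_mul_rpow_le_of_one_lt {x lam : ℝ} (hx : 0 < x) (h : 1 < lam) :
    Real.Gamma x * x ^ lam ≤ Real.Gamma (x + lam) := by
  have g0 := Real.Gamma_pos_of_pos hx
  have g2 := Real.Gamma_pos_of_pos (show 0 < x + lam by linarith)
  have hl : lam ≠ 0 := by linarith
  have hc := Real.convexOn_log_Gamma.2 (show x ∈ Set.Ioi 0 from hx)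
    (show x + lam ∈ Set.Ioi 0 from Set.mem_Ioi.2 (by linarith))
    (show 0 ≤ 1 - 1 / lam by rw [sub_nonneg, div_le_one (by linarith)]; exact h.le)
    (show 0 ≤ 1 / lam by positivity) (by ring)
  simp only [smul_eq_mul, Function.comp] at hc
  rw [show (1 - 1 / lam) * x + 1 / lam * (x + lam) = x + 1 by field_simp; ring,
    Real.Gamma_add_one hx.ne', Real.log_mul hx.ne' g0.ne'] at hc
  rw [← Real.log_le_log_iff (by positivity) g2, Real.log_mul g0.ne' (by positivity),
    Real.log_rpow hx]
  field_simp at hc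
  linarith

/-- Log-convexity of Γ, with x lying between x + λ and x + 1. -/
lemma Gamma_mul_rpow_le_of_neg {x lam : ℝ} (hx : 0 < x) (h : lam < 0) (hxl : 0 < x + lam) :
    Real.Gamma x * x ^ lam ≤ Real.Gamma (x + lam) := by
  have g0 := Real.Gamma_pos_of_pos hx
  have g2 := Real.Gamma_pos_of_pos hxl
  have hl : 0 < 1 - lam := by linarith
  have hc := Real.convexOn_log_Gamma.2 (show x + lam ∈ Set.Ioi 0 from hxl)
    (show x + 1 ∈ Set.Ioi 0 from Set.mem_Ioi.2 (by linarith))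
    (show 0 ≤ 1 / (1 - lam) by positivity)
    (show 0 ≤ -lam / (1 - lam) from div_nonneg (by linarith) hl.le) (by field_simp; ring)
  simp only [smul_eq_mul, Function.comp] at hc
  rw [show 1 / (1 - lam) * (x + lam) + -lam / (1 - lam) * (x + 1) = x by field_simp; ring,
    Real.Gamma_add_one hx.ne', Real.log_mul hx.ne' g0.ne'] at hc
  rw [← Real.log_le_log_iff (by positivity) g2, Real.log_mul g0.ne' (by positivity),
    Real.log_rpow hx]
  field_simp at hc
  linarith

/-- The constant in the bound `|Γ(lam) k! / Γ(k + lam)| ≤ C * k ^ (1 - lam)`. -/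
noncomputable def connConstFactor (lam : ℝ) : ℝ :=
  if lam < 0 then |Real.Gamma lam| else if lam ≤ 1 then 1 / lam else Real.Gamma lam

lemma connConst_zero {lam : ℝ} (hlam : -(1 / 2) < lam) (hlam0 : lam ≠ 0) : connConst lam 0 = 1 := by
  have h2 : Real.Gamma lam ≠ 0 := by simpa using Gamma_nat_add_ne_zero hlam hlam0 0
  simp [connConst, h2]

/-- For 0 < λ < 1 log-convexity gives Γ(x+λ) ≤ x^λ Γ(x), the wrong direction. Instead equality holds
at k = 0 and the induction step is Bernoulli's inequality (1 + 1/m)^λ ≤ 1 + λ/m; this start is the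
source of the constant 1/λ. -/
lemma Gamma_add_one_mul_factorial_le {lam : ℝ} (h0 : 0 < lam) (h1 : lam ≤ 1) (k : ℕ) :
    Real.Gamma (lam + 1) * (k + 1).factorial ≤
      ((k + 1 : ℕ) : ℝ) ^ (1 - lam) * Real.Gamma ((k + 1 : ℕ) + lam) := by
  induction k with
  | zero => simp [add_comm]
  | succ k ih =>
    set m : ℝ := ((k + 1 : ℕ) : ℝ) with hm
    have hmp : 0 < m := by rw [hm]; positivity
    have e : ((k + 1 + 1 : ℕ) : ℝ) = m + 1 := by rw [hm]; push_cast; ring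
    have hG := Real.Gamma_pos_of_pos (show 0 < m + lam by positivity)
    rw [Nat.factorial_succ (k + 1), Nat.cast_mul, e, show m + 1 + lam = m + lam + 1 by ring,
      Real.Gamma_add_one (s := m + lam) (by positivity)]
    have hb : (m + 1) ^ lam ≤ m ^ lam * ((m + lam) / m) := by
      have := rpow_one_add_le_one_add_mul_self (s := 1 / m) (p := lam)
        (by have : 0 < 1 / m := by positivity
            linarith) h0.le h1
      rw [show m + 1 = m * (1 + 1 / m) by field_simp, Real.mul_rpow hmp.le (by positivity)]
      refine mul_le_mul_of_nonneg_left (this.trans_eq ?_) (by positivity)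
      field_simp
    have hs : m ^ (1 - lam) * (m + 1) ≤ (m + 1) ^ (1 - lam) * (m + lam) := by
      rw [Real.rpow_sub hmp, Real.rpow_sub (by positivity), Real.rpow_one, Real.rpow_one]
      have q1 : 0 < m ^ lam := by positivity
      have q2 : 0 < (m + 1) ^ lam := by positivity
      rw [div_mul_eq_mul_div, div_mul_eq_mul_div, div_le_div_iff₀ q1 q2]
      have : m * (m + 1) ^ lam ≤ m ^ lam * (m + lam) := by
        refine (mul_le_mul_of_nonneg_left hb hmp.le).trans_eq ?_
        field_simp
      nlinarith
    calc Real.Gamma (lam + 1) * ((m + 1) * ((k + 1).factorial : ℝ))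
        = (m + 1) * (Real.Gamma (lam + 1) * ((k + 1).factorial : ℝ)) := by ring
      _ ≤ (m + 1) * (m ^ (1 - lam) * Real.Gamma (m + lam)) := by gcongr
      _ = (m ^ (1 - lam) * (m + 1)) * Real.Gamma (m + lam) := by ring
      _ ≤ ((m + 1) ^ (1 - lam) * (m + lam)) * Real.Gamma (m + lam) := by gcongr
      _ = _ := by ring

lemma abs_connConst_le {lam : ℝ} (hlam : -(1 / 2) < lam) (hlam0 : lam ≠ 0) {k : ℕ} (hk : 1 ≤ k) :
    |connConst lam k| ≤ connConstFactor lam * (k : ℝ) ^ (1 - lam) := by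
  have hk' : (1 : ℝ) ≤ k := by exact_mod_cast hk
  have hk0 : (0 : ℝ) < k := by linarith
  have hG := Real.Gamma_pos_of_pos (show 0 < k + lam by linarith)
  have hfac : Real.Gamma k * k = k.factorial := by
    rw [mul_comm, ← Real.Gamma_add_one hk0.ne', Real.Gamma_nat_eq_factorial]
  have key : Real.Gamma k * (k : ℝ) ^ lam ≤ Real.Gamma (k + lam) →
      (k.factorial : ℝ) ≤ (k : ℝ) ^ (1 - lam) * Real.Gamma (k + lam) := by
    intro h
    rw [← hfac, Real.rpow_sub hk0, Real.rpow_one]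
    rw [div_mul_eq_mul_div, le_div_iff₀ (by positivity)]
    nlinarith
  rw [connConst, abs_div, abs_mul, abs_of_pos hG, Nat.abs_cast, div_le_iff₀ hG, connConstFactor]
  split_ifs with h1 h2
  · rw [mul_assoc]
    exact mul_le_mul_of_nonneg_left (key (Gamma_mul_rpow_le_of_neg hk0 h1 (by linarith)))
      (abs_nonneg _)
  · have hp : 0 < lam := lt_of_le_of_ne (not_lt.1 h1) hlam0.symm
    obtain ⟨k, rfl⟩ := Nat.exists_eq_add_of_le' hk
    have h := Gamma_add_one_mul_factorial_le hp h2 k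
    rw [Real.Gamma_add_one hlam0] at h
    rw [abs_of_pos (Real.Gamma_pos_of_pos hp), mul_assoc, one_div, inv_mul_eq_div,
      le_div_iff₀ hp]
    linarith
  · push Not at h2
    rw [abs_of_pos (Real.Gamma_pos_of_pos (by linarith)), mul_assoc]
    exact mul_le_mul_of_nonneg_left (key (Gamma_mul_rpow_le_of_one_lt hk0 h2))
      (Real.Gamma_pos_of_pos (by linarith)).le

/-- At index 0 the gamma quotient is exactly 1, so the separate factor for a_0 only has to undo the
constant built into D_λ(ρ). -/
lemma connConstFactor_mul_zeroFactor {lam : ℝ} (hlam : -(1 / 2) < lam) (hlam0 : lam ≠ 0) :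
    connConstFactor lam * gegenbauerZeroFactor lam = 1 := by
  have h2 : Real.Gamma lam ≠ 0 := by simpa using Gamma_nat_add_ne_zero hlam hlam0 0
  rw [connConstFactor, gegenbauerZeroFactor]
  split_ifs <;> field_simp

lemma gegenbauerD_eq (f : ℂ → ℂ) (lam ρ : ℝ) :
    gegenbauerD f lam ρ = bernsteinMax f ρ * bernsteinLength ρ / (Real.pi * ρ) *
      (connConstFactor lam * connBound lam (1 / ρ ^ 2)) := by
  rw [gegenbauerD, connConstFactor, connBound]
  split_ifs <;> ring

/-! ### Joukowski map, Laurent coefficients and Chebyshev expansions -/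

/-- The Joukowski map. -/
noncomputable def joukowski (u : ℂ) : ℂ := (u + u⁻¹) / 2

lemma norm_joukowski_foci {u : ℂ} (hu : u ≠ 0) :
    ‖joukowski u - 1‖ + ‖joukowski u + 1‖ = ‖u‖ + ‖u‖⁻¹ := by
  have h1 : joukowski u - 1 = (u - 1) ^ 2 / (2 * u) := by rw [joukowski]; field_simp; ring
  have h2 : joukowski u + 1 = (u + 1) ^ 2 / (2 * u) := by rw [joukowski]; field_simp; ring
  have hn : ‖u‖ ≠ 0 := norm_ne_zero_iff.2 hu
  have hp := parallelogram_law_with_norm ℝ u 1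
  rw [h1, h2]
  simp only [norm_div, norm_pow, norm_mul, Complex.norm_ofNat]
  simp only [norm_one] at hp
  field_simp
  nlinarith

lemma joukowski_mem_interior {ρ : ℝ} {u : ℂ} (h1 : 1 ≤ ‖u‖) (h2 : ‖u‖ < ρ) :
    joukowski u ∈ bernsteinInterior ρ := by
  have hu : u ≠ 0 := by rintro rfl; simp at h1; linarith
  rw [bernsteinInterior, Set.mem_ofPred_eq, norm_joukowski_foci hu]
  have p : 0 < ‖u‖ := by linarith
  have q : 0 < ρ := by linarith
  rw [← sub_pos]
  have : ρ + ρ⁻¹ - (‖u‖ + ‖u‖⁻¹) = (ρ - ‖u‖) * (ρ * ‖u‖ - 1) / (ρ * ‖u‖) := by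
    field_simp; ring
  rw [this]
  have : 1 < ρ * ‖u‖ := by nlinarith
  have h3 : 0 < ρ * ‖u‖ - 1 := by linarith
  have h4 : 0 < ρ - ‖u‖ := by linarith
  positivity

lemma joukowski_mem_closure {ρ : ℝ} {u : ℂ} (h1 : 1 ≤ ‖u‖) (h2 : ‖u‖ ≤ ρ) :
    joukowski u ∈ bernsteinInterior ρ ∪ bernsteinEllipse ρ := by
  rcases h2.lt_or_eq with h | h
  · exact Or.inl (joukowski_mem_interior h1 h)
  · exact Or.inr ⟨u, h, rfl⟩

lemma continuousOn_comp_joukowski {f : ℂ → ℂ} {ρ : ℝ}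
    (hfc : ContinuousOn f (bernsteinInterior ρ ∪ bernsteinEllipse ρ)) :
    ContinuousOn (fun u => f (joukowski u)) (Metric.closedBall 0 ρ \ Metric.ball 0 1) := by
  refine hfc.comp ?_ ?_
  · intro u hu
    have hu0 : u ≠ 0 := by
      rintro rfl; simp at hu
    refine ContinuousAt.continuousWithinAt ?_
    unfold joukowski
    fun_prop (disch := exact hu0)
  · intro u hu
    simp at hu
    exact joukowski_mem_closure hu.2 hu.1

/-- The Laurent coefficients of `f ∘ joukowski`, computed on the circle of radius `r`. -/
noncomputable def laurentCoeff (f : ℂ → ℂ) (r : ℝ) (m : ℤ) : ℂ :=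
  (1 / (2 * Real.pi) : ℂ) *
    ∫ θ in (0 : ℝ)..2 * Real.pi, (circleMap 0 r θ) ^ (-m) * f (joukowski (circleMap 0 r θ))

lemma laurentCoeff_eq_circleIntegral (f : ℂ → ℂ) {r : ℝ} (hr : r ≠ 0) (m : ℤ) :
    laurentCoeff f r m = (1 / (2 * Real.pi * Complex.I) : ℂ) *
      ∮ z in C(0, r), (z - 0)⁻¹ • (z ^ (-m) * f (joukowski z)) := by
  rw [laurentCoeff, circleIntegral]
  have : ∀ θ : ℝ, deriv (circleMap 0 r) θ • ((circleMap 0 r θ - 0)⁻¹ •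
      ((circleMap 0 r θ) ^ (-m) * f (joukowski (circleMap 0 r θ)))) =
      Complex.I * ((circleMap 0 r θ) ^ (-m) * f (joukowski (circleMap 0 r θ))) := by
    intro θ
    have h0 : circleMap 0 r θ ≠ 0 := circleMap_ne_center hr
    simp only [deriv_circleMap, smul_eq_mul, sub_zero]
    field_simp
  simp only [this]
  rw [intervalIntegral.integral_const_mul]
  have := Complex.I_ne_zero
  have := Real.pi_ne_zero
  field_simp

/-- Cauchy's theorem on 1 ≤ |u| ≤ ρ, whose interior is mapped into the open elliptic region; on the
boundary continuity suffices. -/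
lemma laurentCoeff_eq {f : ℂ → ℂ} {ρ : ℝ} (hρ : 1 < ρ)
    (hf : AnalyticOnNhd ℂ f (bernsteinInterior ρ))
    (hfc : ContinuousOn f (bernsteinInterior ρ ∪ bernsteinEllipse ρ)) (m : ℤ) :
    laurentCoeff f ρ m = laurentCoeff f 1 m := by
  rw [laurentCoeff_eq_circleIntegral f (by linarith), laurentCoeff_eq_circleIntegral f one_ne_zero]
  congr 1
  refine Complex.circleIntegral_sub_center_inv_smul_eq_of_differentiable_on_annulus_off_countable
    one_pos hρ.le Set.countable_empty ?_ ?_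
  · refine ContinuousOn.mul ?_ (continuousOn_comp_joukowski hfc)
    refine continuousOn_id.zpow₀ _ ?_
    intro u hu
    left
    rintro rfl; simp at hu
  · intro z hz
    simp at hz
    have hz0 : z ≠ 0 := by rintro rfl; simp at hz; linarith
    refine DifferentiableAt.mul (differentiableAt_id.zpow (Or.inl hz0)) ?_
    refine DifferentiableAt.comp (f := joukowski) z ?_ ?_
    · exact (hf _ (joukowski_mem_interior hz.2.le hz.1)).differentiableAt
    · unfold joukowski
      fun_prop (disch := exact hz0)

lemma joukowski_inv (u : ℂ) : joukowski u⁻¹ = joukowski u := by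
  rw [joukowski, joukowski, inv_inv, add_comm]

/-- The Joukowski map is invariant under u ↦ 1/u, which on the unit circle is θ ↦ 2π - θ. -/
lemma laurentCoeff_neg (f : ℂ → ℂ) (m : ℤ) : laurentCoeff f 1 (-m) = laurentCoeff f 1 m := by
  rw [laurentCoeff, laurentCoeff]
  congr 1
  have h := intervalIntegral.integral_comp_sub_left (a := 0) (b := 2 * Real.pi)
    (fun θ => (circleMap 0 1 θ) ^ (-m) * f (joukowski (circleMap 0 1 θ))) (2 * Real.pi)
  rw [sub_self, sub_zero] at h
  rw [← h]
  congr 1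
  ext θ
  have e : circleMap 0 1 (2 * Real.pi - θ) = (circleMap 0 1 θ)⁻¹ := by
    simp only [circleMap_zero, Complex.ofReal_one, one_mul]
    rw [← Complex.exp_neg]
    push_cast
    rw [sub_mul, Complex.exp_sub, Complex.exp_two_pi_mul_I, Complex.exp_neg, one_div]
  rw [e, joukowski_inv, inv_zpow, zpow_neg, zpow_neg, inv_inv]

lemma isCompact_bernsteinEllipse {ρ : ℝ} (hρ : 1 < ρ) : IsCompact (bernsteinEllipse ρ) := by
  have : bernsteinEllipse ρ = joukowski '' Metric.sphere 0 ρ := by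
    ext z
    simp only [bernsteinEllipse, Set.mem_ofPred_eq, Set.mem_image, mem_sphere_zero_iff_norm]
    exact ⟨fun ⟨u, hu, h⟩ => ⟨u, hu, h.symm⟩, fun ⟨u, hu, h⟩ => ⟨u, hu, h.symm⟩⟩
  rw [this]
  refine (isCompact_sphere _ _).image_of_continuousOn ?_
  intro u hu
  have hu0 : u ≠ 0 := by rintro rfl; simp at hu; linarith
  refine ContinuousAt.continuousWithinAt ?_
  unfold joukowski
  fun_prop (disch := exact hu0)

lemma norm_le_bernsteinMax {f : ℂ → ℂ} {ρ : ℝ} (hρ : 1 < ρ)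
    (hfc : ContinuousOn f (bernsteinInterior ρ ∪ bernsteinEllipse ρ)) {z : ℂ}
    (hz : z ∈ bernsteinEllipse ρ) : ‖f z‖ ≤ bernsteinMax f ρ :=
  le_csSup ((isCompact_bernsteinEllipse hρ).image_of_continuousOn
    (hfc.mono Set.subset_union_right).norm).bddAbove ⟨z, hz, rfl⟩

lemma joukowski_circleMap_mem {ρ : ℝ} (hρ : 1 < ρ) (θ : ℝ) :
    joukowski (circleMap 0 ρ θ) ∈ bernsteinEllipse ρ :=
  ⟨circleMap 0 ρ θ, by simp; linarith, rfl⟩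

lemma bernsteinMax_nonneg {f : ℂ → ℂ} {ρ : ℝ} (hρ : 1 < ρ)
    (hfc : ContinuousOn f (bernsteinInterior ρ ∪ bernsteinEllipse ρ)) : 0 ≤ bernsteinMax f ρ :=
  (norm_nonneg _).trans (norm_le_bernsteinMax hρ hfc (joukowski_circleMap_mem hρ 0))

lemma continuous_comp_joukowski_circleMap {f : ℂ → ℂ} {ρ : ℝ} (hρ : 1 < ρ)
    (hfc : ContinuousOn f (bernsteinInterior ρ ∪ bernsteinEllipse ρ)) :
    Continuous fun θ => f (joukowski (circleMap 0 ρ θ)) :=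
  (continuousOn_comp_joukowski hfc).comp_continuous (continuous_circleMap 0 ρ) fun θ => by
    simp [abs_of_pos (zero_lt_one.trans hρ), hρ.le]

lemma norm_laurentCoeff_le {f : ℂ → ℂ} {ρ : ℝ} (hρ : 1 < ρ)
    (hfc : ContinuousOn f (bernsteinInterior ρ ∪ bernsteinEllipse ρ)) (m : ℕ) :
    ‖laurentCoeff f ρ m‖ ≤ bernsteinMax f ρ * (ρ⁻¹) ^ m := by
  have h : ‖∫ θ in (0 : ℝ)..2 * Real.pi, (circleMap 0 ρ θ) ^ (-(m : ℤ)) *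
      f (joukowski (circleMap 0 ρ θ))‖ ≤ (bernsteinMax f ρ * (ρ⁻¹) ^ m) * |2 * Real.pi - 0| := by
    refine intervalIntegral.norm_integral_le_of_norm_le_const fun θ _ => ?_
    rw [norm_mul, norm_zpow, norm_circleMap_zero, abs_of_pos (by linarith), zpow_neg, zpow_natCast,
      mul_comm, inv_pow]
    exact mul_le_mul_of_nonneg_right (norm_le_bernsteinMax hρ hfc (joukowski_circleMap_mem hρ θ))
      (by positivity)
  rw [laurentCoeff, norm_mul]
  have hp := Real.pi_pos
  rw [sub_zero, abs_of_pos (by positivity)] at h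
  have e : ‖(1 / (2 * Real.pi) : ℂ)‖ = 1 / (2 * Real.pi) := by
    simp [abs_of_pos hp]
  rw [e]
  calc _ ≤ 1 / (2 * Real.pi) * ((bernsteinMax f ρ * (ρ⁻¹) ^ m) * (2 * Real.pi)) := by gcongr
    _ = _ := by field_simp

lemma summable_laurentCoeff {f : ℂ → ℂ} {ρ : ℝ} (hρ : 1 < ρ)
    (hf : AnalyticOnNhd ℂ f (bernsteinInterior ρ))
    (hfc : ContinuousOn f (bernsteinInterior ρ ∪ bernsteinEllipse ρ)) :
    Summable (laurentCoeff f 1) := by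
  have h : Summable fun m : ℕ => laurentCoeff f 1 m := by
    refine Summable.of_norm_bounded
      ((summable_geometric_of_lt_one (by positivity) (inv_lt_one_of_one_lt₀ hρ)).mul_left
        (bernsteinMax f ρ)) fun m => ?_
    rw [← laurentCoeff_eq hρ hf hfc]
    exact norm_laurentCoeff_le hρ hfc m
  exact h.of_nat_of_neg (by simpa only [laurentCoeff_neg] using h)

instance : Fact (0 < 2 * Real.pi) := ⟨Real.two_pi_pos⟩

lemma fourier_coe_two_pi (m : ℤ) (θ : ℝ) :
    fourier m (θ : AddCircle (2 * Real.pi)) = (circleMap 0 1 θ) ^ m := by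
  rw [fourier_coe_apply, circleMap_zero, Complex.ofReal_one, one_mul, ← Complex.exp_int_mul]
  congr 1
  push_cast
  have : (Real.pi : ℂ) ≠ 0 := by exact_mod_cast Real.pi_ne_zero
  field_simp

lemma joukowski_circleMap_one (θ : ℝ) : joukowski (circleMap 0 1 θ) = (Real.cos θ : ℂ) := by
  rw [joukowski, circleMap_zero, Complex.ofReal_one, one_mul, ← Complex.exp_neg, Complex.ofReal_cos,
    Complex.cos, neg_mul]

/-- On the unit circle the Laurent coefficients are Fourier coefficients of a continuous function.
Their geometric decay makes them summable, so the Fourier series converges pointwise. -/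
lemma hasSum_laurentCoeff {f : ℂ → ℂ} {ρ : ℝ} (hρ : 1 < ρ)
    (hf : AnalyticOnNhd ℂ f (bernsteinInterior ρ))
    (hfc : ContinuousOn f (bernsteinInterior ρ ∪ bernsteinEllipse ρ)) (φ : ℝ) :
    HasSum (fun m : ℤ => laurentCoeff f 1 m * (circleMap 0 1 φ) ^ m) (f (Real.cos φ : ℂ)) := by
  let G : C(AddCircle (2 * Real.pi), ℂ) :=
    ⟨fun x => f (joukowski (fourier 1 x)),
      (continuousOn_comp_joukowski hfc).comp_continuous (fourier 1).continuous fun x => by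
        have : ‖fourier 1 x‖ = 1 := by rw [fourier_apply]; exact Circle.norm_coe _
        rw [Set.mem_sdiff, mem_closedBall_zero_iff, mem_ball_zero_iff, this]
        exact ⟨hρ.le, lt_irrefl 1⟩⟩
  have hG : ∀ θ : ℝ, G (θ : AddCircle (2 * Real.pi)) = f (joukowski (circleMap 0 1 θ)) := by
    intro θ
    change f (joukowski (fourier 1 (θ : AddCircle (2 * Real.pi)))) = _
    rw [fourier_coe_two_pi, zpow_one]
  have hc : fourierCoeff G = laurentCoeff f 1 := by
    ext m
    rw [fourierCoeff_eq_intervalIntegral _ _ 0, zero_add, laurentCoeff]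
    simp only [hG, fourier_coe_two_pi, smul_eq_mul, Complex.real_smul]
    push_cast
    rfl
  have h := has_pointwise_sum_fourier_series_of_summable (f := G)
    (by rw [hc]; exact summable_laurentCoeff hρ hf hfc) (φ : AddCircle (2 * Real.pi))
  simp only [hG, hc, fourier_coe_two_pi, smul_eq_mul, joukowski_circleMap_one] at h
  exact h

/-- Pairing m with -m counts the index 0 twice, hence the additional `laurentCoeff f 1 0`. -/
lemma hasSum_chebyshevT {f : ℂ → ℂ} {ρ : ℝ} (hρ : 1 < ρ)
    (hf : AnalyticOnNhd ℂ f (bernsteinInterior ρ))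
    (hfc : ContinuousOn f (bernsteinInterior ρ ∪ bernsteinEllipse ρ)) {x : ℝ}
    (hx : x ∈ Set.Icc (-1 : ℝ) 1) :
    HasSum (fun m : ℕ => laurentCoeff f 1 m * (2 * (((Chebyshev.T ℝ m).eval x : ℝ) : ℂ)))
      (f x + laurentCoeff f 1 0) := by
  have h := (hasSum_laurentCoeff hρ hf hfc (Real.arccos x)).nat_add_neg
  rw [Real.cos_arccos hx.1 hx.2, zpow_zero, mul_one] at h
  convert! h using 2 with m
  rw [laurentCoeff_neg, ← mul_add]
  congr 1
  have h2 := Chebyshev.T_real_cos (Real.arccos x) m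
  rw [Real.cos_arccos hx.1 hx.2] at h2
  rw [h2, zpow_neg, zpow_natCast, circleMap_zero, Complex.ofReal_one, one_mul, ← Complex.exp_nat_mul,
    ← Complex.exp_neg, Complex.ofReal_cos, Complex.two_cos]
  push_cast
  ring_nf

lemma abs_eval_U_le {x : ℝ} (hx : x ∈ Set.Icc (-1 : ℝ) 1) (m : ℕ) :
    |(Chebyshev.U ℝ m).eval x| ≤ m + 1 := by
  induction m using Nat.twoStepInduction with
  | zero => simp
  | one =>
    have := abs_le.2 hx
    simp [abs_mul]; linarith
  | more m ih _ =>
    have h := congrArg (eval x) (Chebyshev.U_eq_two_mul_T_add_U ℝ m)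
    have hT := Chebyshev.abs_eval_T_real_le_one (m + 2) (abs_le.2 hx)
    simp only [eval_add, eval_mul, eval_ofNat] at h
    push_cast
    rw [h]
    refine (abs_add_le _ _).trans ?_
    rw [abs_mul, abs_two]
    linarith

/-- The coefficients of `f` in the Chebyshev polynomials of the second kind. -/
noncomputable def chebyshevUCoeff (f : ℂ → ℂ) (m : ℕ) : ℂ :=
  laurentCoeff f 1 m - laurentCoeff f 1 (m + 2 : ℕ)

lemma summable_norm_laurentCoeff_mul {f : ℂ → ℂ} {ρ : ℝ} (hρ : 1 < ρ)
    (hf : AnalyticOnNhd ℂ f (bernsteinInterior ρ))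
    (hfc : ContinuousOn f (bernsteinInterior ρ ∪ bernsteinEllipse ρ)) :
    Summable fun m : ℕ => ‖laurentCoeff f 1 m‖ * (m + 1) := by
  have hr : ‖ρ⁻¹‖ < 1 := by
    rw [Real.norm_of_nonneg (by positivity)]; exact inv_lt_one_of_one_lt₀ hρ
  have h1 := summable_pow_mul_geometric_of_norm_lt_one 1 hr
  have h0 := summable_geometric_of_norm_lt_one hr
  refine Summable.of_nonneg_of_le (fun m => by positivity) (fun m => ?_)
    ((h1.add h0).mul_left (bernsteinMax f ρ))
  rw [← laurentCoeff_eq hρ hf hfc]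
  refine (mul_le_mul_of_nonneg_right (norm_laurentCoeff_le hρ hfc m) (by positivity)).trans_eq ?_
  ring

lemma summable_norm_chebyshevUCoeff_mul {f : ℂ → ℂ} {ρ : ℝ} (hρ : 1 < ρ)
    (hf : AnalyticOnNhd ℂ f (bernsteinInterior ρ))
    (hfc : ContinuousOn f (bernsteinInterior ρ ∪ bernsteinEllipse ρ)) :
    Summable fun m : ℕ => ‖chebyshevUCoeff f m‖ * (m + 1) := by
  have h := summable_norm_laurentCoeff_mul hρ hf hfc
  refine Summable.of_nonneg_of_le (fun m => by positivity) (fun m => ?_)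
    (h.add ((summable_nat_add_iff 2).2 h))
  rw [chebyshevUCoeff]
  have := norm_sub_le (laurentCoeff f 1 m) (laurentCoeff f 1 (m + 2 : ℕ))
  have h2 : (0 : ℝ) ≤ ‖laurentCoeff f 1 (m + 2 : ℕ)‖ * 2 := by positivity
  refine (mul_le_mul_of_nonneg_right this (by positivity)).trans ?_
  push_cast at h2 ⊢
  nlinarith

/-- Summation by parts with 2 T_m = U_m - U_{m-2}. -/
lemma hasSum_chebyshevU {f : ℂ → ℂ} {ρ : ℝ} (hρ : 1 < ρ)
    (hf : AnalyticOnNhd ℂ f (bernsteinInterior ρ))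
    (hfc : ContinuousOn f (bernsteinInterior ρ ∪ bernsteinEllipse ρ)) {x : ℝ}
    (hx : x ∈ Set.Icc (-1 : ℝ) 1) :
    HasSum (fun m : ℕ => chebyshevUCoeff f m * (((Chebyshev.U ℝ m).eval x : ℝ) : ℂ)) (f x) := by
  have hA : Summable fun m : ℕ => laurentCoeff f 1 m * (((Chebyshev.U ℝ m).eval x : ℝ) : ℂ) := by
    refine Summable.of_norm_bounded (summable_norm_laurentCoeff_mul hρ hf hfc) fun m => ?_
    rw [norm_mul, Complex.norm_real, Real.norm_eq_abs]
    exact mul_le_mul_of_nonneg_left (abs_eval_U_le hx m) (norm_nonneg _)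
  have hB := hA.hasSum.sub (hasSum_chebyshevT hρ hf hfc hx)
  have e : ∀ m : ℕ, laurentCoeff f 1 m * (((Chebyshev.U ℝ m).eval x : ℝ) : ℂ) -
      laurentCoeff f 1 m * (2 * (((Chebyshev.T ℝ m).eval x : ℝ) : ℂ)) =
      laurentCoeff f 1 m * (((Chebyshev.U ℝ ((m : ℤ) - 2)).eval x : ℝ) : ℂ) := by
    intro m
    have h := congrArg (eval x) (Chebyshev.two_mul_T_eq_U_sub_U (R := ℝ) ((m : ℤ) - 2))
    simp only [eval_sub, eval_mul, eval_ofNat, sub_add_cancel] at h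
    have h' : (((Chebyshev.U ℝ ((m : ℤ) - 2)).eval x : ℝ) : ℂ) =
        ((Chebyshev.U ℝ m).eval x - 2 * (Chebyshev.T ℝ m).eval x : ℝ) := by
      rw [h]; push_cast; ring
    rw [h']
    push_cast
    ring
  simp only [e] at hB
  -- Splitting off m = 0, 1 allows the shift by two. There U_{-2} = -1 cancels the doubled constant
  -- term and U_{-1} = 0.
  have hB2 := (hasSum_nat_add_iff' 2).2 hB
  have hC := hA.hasSum.sub hB2
  have hv : ∀ S : ℂ, S - (S - (f x + laurentCoeff f 1 0) - ∑ i ∈ Finset.range 2,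
      laurentCoeff f 1 i * (((Chebyshev.U ℝ ((i : ℤ) - 2)).eval x : ℝ) : ℂ)) = f x := by
    intro S
    simp [Finset.sum_range_succ, Chebyshev.U_neg_two]
    ring
  rw [hv] at hC
  refine hC.congr_fun fun m => ?_
  rw [chebyshevUCoeff]
  push_cast
  rw [add_sub_cancel_right]
  ring

/-! ### Contour integral for the coefficients and the final estimate -/

lemma hasDerivAt_bernsteinParam {ρ : ℝ} (hρ : ρ ≠ 0) (θ : ℝ) :
    HasDerivAt (bernsteinParam ρ)
      (Complex.I * (circleMap 0 ρ θ - (circleMap 0 ρ θ)⁻¹) / 2) θ := by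
  have h0 : circleMap 0 ρ θ ≠ 0 := circleMap_ne_center hρ
  have h := hasDerivAt_circleMap 0 ρ θ
  refine ((h.add (h.inv h0)).div_const 2).congr_deriv ?_
  simp only [circleMap_zero] at h0 ⊢
  field_simp
  ring

lemma deriv_bernsteinParam {ρ : ℝ} (hρ : ρ ≠ 0) (θ : ℝ) :
    deriv (bernsteinParam ρ) θ = Complex.I * (circleMap 0 ρ θ - (circleMap 0 ρ θ)⁻¹) / 2 :=
  (hasDerivAt_bernsteinParam hρ θ).deriv

lemma continuous_deriv_bernsteinParam {ρ : ℝ} (hρ : ρ ≠ 0) :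
    Continuous (deriv (bernsteinParam ρ)) := by
  rw [funext (deriv_bernsteinParam hρ)]
  have h0 : ∀ θ, circleMap 0 ρ θ ≠ 0 := fun θ => circleMap_ne_center hρ
  have hc := continuous_circleMap 0 ρ
  have := hc.inv₀ h0
  fun_prop

/-- The integrand of the contour integral representing the Gegenbauer coefficient of index `k`,
without its hypergeometric factor. -/
noncomputable def contourIntegrand (f : ℂ → ℂ) (ρ : ℝ) (k : ℕ) (θ : ℝ) : ℂ :=
  f (joukowski (circleMap 0 ρ θ)) * deriv (bernsteinParam ρ) θ * ((circleMap 0 ρ θ)⁻¹) ^ (k + 1)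

lemma continuous_inv_circleMap {ρ : ℝ} (hρ : ρ ≠ 0) :
    Continuous fun θ => (circleMap 0 ρ θ)⁻¹ :=
  (continuous_circleMap 0 ρ).inv₀ fun _ => circleMap_ne_center hρ

lemma continuous_contourIntegrand {f : ℂ → ℂ} {ρ : ℝ} (hρ : 1 < ρ)
    (hfc : ContinuousOn f (bernsteinInterior ρ ∪ bernsteinEllipse ρ)) (k : ℕ) :
    Continuous (contourIntegrand f ρ k) :=
  ((continuous_comp_joukowski_circleMap hρ hfc).mul
    (continuous_deriv_bernsteinParam (by linarith))).mul
      ((continuous_inv_circleMap (by linarith)).pow _)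

lemma norm_contourIntegrand_le {f : ℂ → ℂ} {ρ : ℝ} (hρ : 1 < ρ)
    (hfc : ContinuousOn f (bernsteinInterior ρ ∪ bernsteinEllipse ρ)) (k : ℕ) (θ : ℝ) :
    ‖contourIntegrand f ρ k θ‖ ≤
      bernsteinMax f ρ * (ρ⁻¹) ^ (k + 1) * ‖deriv (bernsteinParam ρ) θ‖ := by
  rw [contourIntegrand, norm_mul, norm_mul, norm_pow, norm_inv, norm_circleMap_zero,
    abs_of_pos (by linarith), mul_right_comm]
  gcongr
  exact norm_le_bernsteinMax hρ hfc (joukowski_circleMap_mem hρ θ)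

/-- The factor 1 - u⁻² from the difference of Laurent coefficients is, up to u and constants, the
derivative of the parametrization. Arc length thereby enters the bound. -/
lemma chebyshevUCoeff_eq_contour {f : ℂ → ℂ} {ρ : ℝ} (hρ : 1 < ρ)
    (hf : AnalyticOnNhd ℂ f (bernsteinInterior ρ))
    (hfc : ContinuousOn f (bernsteinInterior ρ ∪ bernsteinEllipse ρ)) (k j : ℕ) :
    chebyshevUCoeff f (k + 2 * j) = 1 / (Real.pi * Complex.I) *
      ∫ θ in (0 : ℝ)..2 * Real.pi, contourIntegrand f ρ k θ * (((circleMap 0 ρ θ)⁻¹) ^ 2) ^ j := by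
  have hρ0 : ρ ≠ 0 := by linarith
  have hi := continuous_inv_circleMap hρ0
  have hg := continuous_comp_joukowski_circleMap hρ hfc
  have hint : ∀ m : ℕ, IntervalIntegrable (fun θ => (circleMap 0 ρ θ) ^ (-(m : ℤ)) *
      f (joukowski (circleMap 0 ρ θ))) MeasureTheory.volume 0 (2 * Real.pi) := by
    intro m
    refine Continuous.intervalIntegrable ?_ _ _
    simp only [zpow_neg, zpow_natCast, ← inv_pow]
    exact (hi.pow m).mul hg
  rw [chebyshevUCoeff, ← laurentCoeff_eq hρ hf hfc, ← laurentCoeff_eq hρ hf hfc, laurentCoeff,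
    laurentCoeff, ← mul_sub, ← intervalIntegral.integral_sub (hint _) (hint _),
    ← intervalIntegral.integral_const_mul, ← intervalIntegral.integral_const_mul]
  congr 1
  ext θ
  have h0 : circleMap 0 ρ θ ≠ 0 := circleMap_ne_center hρ0
  have hpi : (Real.pi : ℂ) ≠ 0 := by exact_mod_cast Real.pi_ne_zero
  rw [contourIntegrand, deriv_bernsteinParam hρ0]
  simp only [zpow_neg, zpow_natCast, ← inv_pow]
  have e1 : ((circleMap 0 ρ θ)⁻¹) ^ (k + 2 * j) = (circleMap 0 ρ θ) * ((circleMap 0 ρ θ)⁻¹) ^ (k + 1) *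
      (((circleMap 0 ρ θ)⁻¹) ^ 2) ^ j := by
    rw [← pow_mul, pow_add, pow_succ]
    field_simp
  rw [pow_add _ (k + 2 * j) 2, e1]
  set u := circleMap 0 ρ θ
  have e2 : u * u⁻¹ ^ 2 = u⁻¹ := by field_simp
  have hI := Complex.I_ne_zero
  generalize u⁻¹ ^ (k + 1) = p at *
  generalize (u⁻¹ ^ 2) ^ j = q at *
  have : 1 / (Real.pi * Complex.I) * (f (joukowski u) * (Complex.I * (u - u⁻¹) / 2) * p * q) =
      1 / (2 * Real.pi) * (f (joukowski u) * (u - u⁻¹) * p * q) := by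
    field_simp
  rw [this]
  linear_combination -(1 / (2 * Real.pi) * p * q * f (joukowski u)) * e2

/-- Termwise integration of the U-series, dominated through |U_m| ≤ m + 1 on [-1, 1]; only the
indices k + 2j contribute. -/
lemma hasSum_gegenbauerCoeff {f : ℂ → ℂ} {ρ lam : ℝ} (hρ : 1 < ρ)
    (hf : AnalyticOnNhd ℂ f (bernsteinInterior ρ))
    (hfc : ContinuousOn f (bernsteinInterior ρ ∪ bernsteinEllipse ρ))
    (hlam : -(1 / 2) < lam) (hlam0 : lam ≠ 0) (k : ℕ) :
    HasSum (fun j => chebyshevUCoeff f (k + 2 * j) * (connConst lam k * connCoeff lam k j : ℝ))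
      (gegenbauerCoeff f lam k) := by
  set c : ℝ := (ascPochhammer ℝ k).eval (2 * lam) / k.factorial with hc
  set w : ℝ → ℝ := fun x => gegenbauerWeight lam x * gegenbauerC lam k x with hw
  have hwq : ∀ q : ℝ[X], (fun x => w x * q.eval x) =
      fun x => c * (gegenbauerWeight lam x * (gegenbauerPoly lam k * q).eval x) := by
    intro q; ext x
    simp only [hw, gegenbauerC_eq, eval_mul, hc]; ring
  have hwi : ∀ q : ℝ[X], IntervalIntegrable (fun x => w x * q.eval x) MeasureTheory.volume (-1) 1 := by
    intro q
    rw [hwq]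
    exact (intervalIntegrable_weight_mul hlam _).const_mul c
  have hw1 : IntervalIntegrable w MeasureTheory.volume (-1) 1 := by simpa using hwi 1
  have h1 : HasSum (fun m : ℕ => ∫ x in (-1 : ℝ)..1, ((w x : ℝ) : ℂ) *
      (chebyshevUCoeff f m * (((Chebyshev.U ℝ m).eval x : ℝ) : ℂ)))
      (∫ x in (-1 : ℝ)..1, ((w x : ℝ) : ℂ) * f x) := by
    refine intervalIntegral.hasSum_integral_of_dominated_convergence
      (fun m x => |w x| * (‖chebyshevUCoeff f m‖ * (m + 1))) ?_ ?_ ?_ ?_ ?_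
    · intro m
      rw [Set.uIoc_of_le (by norm_num)]
      refine (Complex.continuous_ofReal.comp_aestronglyMeasurable
        hw1.1.aestronglyMeasurable).mul (Continuous.aestronglyMeasurable ?_)
      exact continuous_const.mul (Complex.continuous_ofReal.comp (Chebyshev.U ℝ m).continuous)
    · intro m
      refine Filter.Eventually.of_forall fun x hx => ?_
      rw [Set.uIoc_of_le (by norm_num)] at hx
      rw [norm_mul, norm_mul, Complex.norm_real, Complex.norm_real, Real.norm_eq_abs,
        Real.norm_eq_abs]
      gcongr
      exact abs_eval_U_le ⟨hx.1.le, hx.2⟩ m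
    · exact Filter.Eventually.of_forall fun x _ =>
        (summable_norm_chebyshevUCoeff_mul hρ hf hfc).mul_left _
    · simp only [tsum_mul_left]
      exact hw1.abs.mul_const _
    · refine Filter.Eventually.of_forall fun x hx => ?_
      rw [Set.uIoc_of_le (by norm_num)] at hx
      exact (hasSum_chebyshevU hρ hf hfc ⟨hx.1.le, hx.2⟩).mul_left _
  have h2 : ∀ m : ℕ, ∫ x in (-1 : ℝ)..1, ((w x : ℝ) : ℂ) *
      (chebyshevUCoeff f m * (((Chebyshev.U ℝ m).eval x : ℝ) : ℂ)) =
      chebyshevUCoeff f m * ((c * chebyshevMoment lam k m : ℝ) : ℂ) := by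
    intro m
    have : ∀ x : ℝ, ((w x : ℝ) : ℂ) * (chebyshevUCoeff f m * (((Chebyshev.U ℝ m).eval x : ℝ) : ℂ)) =
        chebyshevUCoeff f m * ((w x * (Chebyshev.U ℝ m).eval x : ℝ) : ℂ) := by
      intro x; push_cast; ring
    simp only [this]
    rw [intervalIntegral.integral_const_mul, intervalIntegral.integral_ofReal, hwq,
      intervalIntegral.integral_const_mul]
    rfl
  simp only [h2] at h1
  have hinj : Function.Injective fun j : ℕ => k + 2 * j := fun a b h => by
    simp only at h; omega
  rw [← hinj.hasSum_iff] at h1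
  · have h3 := h1.mul_left (1 / (gegenbauerH lam k : ℂ))
    refine h3.congr_fun fun j => ?_
    rw [Function.comp_apply, chebyshevMoment_add_two_mul hlam,
      ← chebyshevMoment_div_gegenbauerH hlam hlam0, ← hc]
    push_cast
    ring
  · intro m hm
    rw [chebyshevMoment_eq_zero hlam k m fun j hj => hm ⟨j, hj.symm⟩]
    simp

lemma gegenbauerCoeff_eq_contour {f : ℂ → ℂ} {ρ lam : ℝ} (hρ : 1 < ρ)
    (hf : AnalyticOnNhd ℂ f (bernsteinInterior ρ))
    (hfc : ContinuousOn f (bernsteinInterior ρ ∪ bernsteinEllipse ρ))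
    (hlam : -(1 / 2) < lam) (hlam0 : lam ≠ 0) (k : ℕ) :
    gegenbauerCoeff f lam k = connConst lam k / (Real.pi * Complex.I) *
      ∫ θ in (0 : ℝ)..2 * Real.pi, contourIntegrand f ρ k θ *
        ∑' j, (connCoeff lam k j : ℂ) * (((circleMap 0 ρ θ)⁻¹) ^ 2) ^ j := by
  have hρ0 : ρ ≠ 0 := by linarith
  have hn : ∀ θ, ‖((circleMap 0 ρ θ)⁻¹) ^ 2‖ = (ρ⁻¹) ^ 2 := by
    intro θ
    rw [norm_pow, norm_inv, norm_circleMap_zero, abs_of_pos (by linarith)]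
  have hr1 : (ρ⁻¹) ^ 2 < 1 :=
    pow_lt_one₀ (by positivity) (inv_lt_one_of_one_lt₀ hρ) two_ne_zero
  have hsumm := summable_connCoeff hlam hlam0 k (sq_nonneg ρ⁻¹) hr1
  have hF := continuous_contourIntegrand hρ hfc k
  have he : ∀ j θ, ‖(connCoeff lam k j : ℂ) * (((circleMap 0 ρ θ)⁻¹) ^ 2) ^ j‖ =
      |connCoeff lam k j| * ((ρ⁻¹) ^ 2) ^ j := by
    intro j θ
    rw [norm_mul, norm_pow _ j, hn, Complex.norm_real, Real.norm_eq_abs]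
  have h1 : HasSum (fun j => ∫ θ in (0 : ℝ)..2 * Real.pi, contourIntegrand f ρ k θ *
      ((connCoeff lam k j : ℂ) * (((circleMap 0 ρ θ)⁻¹) ^ 2) ^ j))
      (∫ θ in (0 : ℝ)..2 * Real.pi, contourIntegrand f ρ k θ *
        ∑' j, (connCoeff lam k j : ℂ) * (((circleMap 0 ρ θ)⁻¹) ^ 2) ^ j) := by
    refine intervalIntegral.hasSum_integral_of_dominated_convergence
      (fun j θ => ‖contourIntegrand f ρ k θ‖ * (|connCoeff lam k j| * ((ρ⁻¹) ^ 2) ^ j))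
      ?_ ?_ ?_ ?_ ?_
    · intro j
      exact (hF.mul (continuous_const.mul
        (((continuous_inv_circleMap hρ0).pow 2).pow j))).aestronglyMeasurable
    · intro j
      exact Filter.Eventually.of_forall fun θ _ => by rw [norm_mul, he]
    · exact Filter.Eventually.of_forall fun θ _ => hsumm.mul_left _
    · simp only [tsum_mul_left]
      exact (hF.norm.mul continuous_const).intervalIntegrable _ _
    · refine Filter.Eventually.of_forall fun θ _ => HasSum.mul_left _ (Summable.hasSum ?_)
      refine Summable.of_norm ?_
      simpa only [he] using hsumm
  have h2 := h1.mul_left ((connConst lam k : ℂ) / (Real.pi * Complex.I))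
  refine (hasSum_gegenbauerCoeff hρ hf hfc hlam hlam0 k).unique (h2.congr_fun fun j => ?_)
  rw [chebyshevUCoeff_eq_contour hρ hf hfc]
  have : ∀ θ, contourIntegrand f ρ k θ *
      ((connCoeff lam k j : ℂ) * (((circleMap 0 ρ θ)⁻¹) ^ 2) ^ j) =
      (connCoeff lam k j : ℂ) * (contourIntegrand f ρ k θ * (((circleMap 0 ρ θ)⁻¹) ^ 2) ^ j) := by
    intro θ; ring
  simp only [this]
  rw [intervalIntegral.integral_const_mul]
  push_cast
  ring

lemma norm_gegenbauerCoeff_le {f : ℂ → ℂ} {ρ lam : ℝ} (hρ : 1 < ρ)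
    (hf : AnalyticOnNhd ℂ f (bernsteinInterior ρ))
    (hfc : ContinuousOn f (bernsteinInterior ρ ∪ bernsteinEllipse ρ))
    (hlam : -(1 / 2) < lam) (hlam0 : lam ≠ 0) (k : ℕ) :
    ‖gegenbauerCoeff f lam k‖ ≤ |connConst lam k| / Real.pi *
      (bernsteinMax f ρ * (ρ⁻¹) ^ (k + 1) * bernsteinLength ρ * connBound lam (1 / ρ ^ 2)) := by
  have hρ0 : ρ ≠ 0 := by linarith
  have hn : ∀ θ, ‖((circleMap 0 ρ θ)⁻¹) ^ 2‖ = 1 / ρ ^ 2 := by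
    intro θ
    rw [norm_pow, norm_inv, norm_circleMap_zero, abs_of_pos (by linarith), inv_pow, one_div]
  have hr1 : 1 / ρ ^ 2 < 1 := by
    rw [div_lt_one (by positivity)]; nlinarith
  have hb : ∀ θ, ‖∑' j, (connCoeff lam k j : ℂ) * (((circleMap 0 ρ θ)⁻¹) ^ 2) ^ j‖ ≤
      connBound lam (1 / ρ ^ 2) := by
    intro θ
    have := norm_tsum_connCoeff_le hlam hlam0 k (x := ((circleMap 0 ρ θ)⁻¹) ^ 2) (by rwa [hn])
    rwa [hn] at this
  have hL : Continuous fun θ => ‖deriv (bernsteinParam ρ) θ‖ :=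
    (continuous_deriv_bernsteinParam hρ0).norm
  rw [gegenbauerCoeff_eq_contour hρ hf hfc hlam hlam0, norm_mul]
  have e : ‖(connConst lam k : ℂ) / (Real.pi * Complex.I)‖ = |connConst lam k| / Real.pi := by
    simp [abs_of_pos Real.pi_pos]
  rw [e]
  refine mul_le_mul_of_nonneg_left ?_ (div_nonneg (abs_nonneg _) Real.pi_pos.le)
  have hM := bernsteinMax_nonneg hρ hfc
  refine (intervalIntegral.norm_integral_le_of_norm_le (g := fun θ =>
    bernsteinMax f ρ * (ρ⁻¹) ^ (k + 1) * ‖deriv (bernsteinParam ρ) θ‖ * connBound lam (1 / ρ ^ 2))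
    Real.two_pi_pos.le (Filter.Eventually.of_forall fun θ _ => ?_) ?_).trans_eq ?_
  · rw [norm_mul]
    exact mul_le_mul (norm_contourIntegrand_le hρ hfc k θ) (hb θ) (norm_nonneg _) (by positivity)
  · exact ((continuous_const.mul hL).mul continuous_const).intervalIntegrable _ _
  · rw [intervalIntegral.integral_mul_const, intervalIntegral.integral_const_mul, bernsteinLength]

lemma bernsteinLength_nonneg (ρ : ℝ) : 0 ≤ bernsteinLength ρ :=
  intervalIntegral.integral_nonneg Real.two_pi_pos.le fun _ _ => norm_nonneg _

lemma connBound_nonneg {lam : ℝ} (hlam : -(1 / 2) < lam) (hlam0 : lam ≠ 0) {x : ℂ} (hx : ‖x‖ < 1) :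
    0 ≤ connBound lam ‖x‖ :=
  (norm_nonneg _).trans (norm_tsum_connCoeff_le hlam hlam0 0 hx)

theorem theorem4p1 (f : ℂ → ℂ) (ρ lam : ℝ) (hρ : 1 < ρ)
    (hf : AnalyticOnNhd ℂ f (bernsteinInterior ρ))
    (hfc : ContinuousOn f (bernsteinInterior ρ ∪ bernsteinEllipse ρ))
    (hlam : -(1 / 2) < lam) (hlam0 : lam ≠ 0) :
    ‖gegenbauerCoeff f lam 0‖ ≤ gegenbauerD f lam ρ * gegenbauerZeroFactor lam ∧
    ∀ k : ℕ, 1 ≤ k →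
      ‖gegenbauerCoeff f lam k‖ ≤ gegenbauerD f lam ρ * ((k : ℝ) ^ (1 - lam) / ρ ^ k) := by
  have hρ0 : 0 < ρ := by linarith
  have hpi := Real.pi_pos
  have hM := bernsteinMax_nonneg hρ hfc
  have hL := bernsteinLength_nonneg ρ
  have hB : 0 ≤ connBound lam (1 / ρ ^ 2) := by
    have h : ‖((1 / ρ ^ 2 : ℝ) : ℂ)‖ = 1 / ρ ^ 2 := by
      rw [Complex.norm_real, Real.norm_of_nonneg (by positivity)]
    have h1 : 1 / ρ ^ 2 < 1 := by
      rw [div_lt_one (by positivity)]; nlinarith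
    have := connBound_nonneg hlam hlam0 (x := ((1 / ρ ^ 2 : ℝ) : ℂ)) (by rwa [h])
    rwa [h] at this
  refine ⟨?_, fun k hk => ?_⟩
  · refine (norm_gegenbauerCoeff_le hρ hf hfc hlam hlam0 0).trans_eq ?_
    rw [connConst_zero hlam hlam0, gegenbauerD_eq]
    have h := connConstFactor_mul_zeroFactor hlam hlam0
    rw [show ∀ a b c d : ℝ, a * (b * c) * d = a * c * (b * d) by intros; ring, h, abs_one, zero_add,
      pow_one]
    field_simp
  · refine (norm_gegenbauerCoeff_le hρ hf hfc hlam hlam0 k).trans ?_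
    calc _ ≤ connConstFactor lam * (k : ℝ) ^ (1 - lam) / Real.pi * (bernsteinMax f ρ *
          (ρ⁻¹) ^ (k + 1) * bernsteinLength ρ * connBound lam (1 / ρ ^ 2)) := by
          gcongr
          exact abs_connConst_le hlam hlam0 hk
      _ = _ := by
          -- Of the k + 1 factors 1/ρ, one belongs to D_λ(ρ) and the others form ρ^(-k).
          rw [gegenbauerD_eq, inv_pow, pow_succ]
          field_simp
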